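/- Let $g:\mathbb R\to\mathbb C$ and $\mathcal N\in\mathbb C$ be such that $\psi_\infty=\mathcal N g\in L^2(\mathbb R)$ and $\|\psi_\infty\|_2=1$. Let $r'\in\mathbb R$ and $\sigma'=e^{r'}$. For $n\ge 0$ let $$h_n(y)=\pi^{-1/4}(2^n n!)^{-1/2}H_n(y)e^{-y^2/2},\qquad \phi_{n,r'}(x)=\frac{1}{\sqrt{\sqrt2\,\sigma'}}\,h_n\!\left(\frac{x}{\sqrt2\,\sigma'}\right),$$ where $H_n$ is the physicists' Hermite polynomial, and let $\psi_{N,r'}$ be the orthogonal projection in $L^2(\mathbb R)$ of $\psi_\infty$ onto the span of the squeezed Fock functions $\phi_{0,r'},\dots,\phi_{N-1,r'}$. Let $$F_{r'}(y)=\sqrt{\sqrt2\,\sigma'}\;\psi_\infty(\sqrt2\,\sigma' y),\qquad \mathcal A=\frac1{\sqrt2}\left(y+\frac{\mathrm d}{\mathrm dy}\right),$$ and assume that $F_{r'}$ is a Schwartz function on $\mathbb R$. Then the following hold. (i) For every integer $s\ge1$, $\mathcal A^sF_{r'}\in L^2(\mathbb R)$, and for every $N\ge s$ $$\|\psi_\infty-\psi_{N,r'}\|_2\le\frac{\|\mathcal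 A^sF_{r'}\|_2}{\sqrt{N(N-1)\cdots(N-s+1)}}.$$ Consequently, for fixed $r'$ and $s$, $\|\psi_\infty-\psi_{N,r'}\|_2=\mathcal O(N^{-s/2})$ as $N\to\infty$. (ii) Let $\rho>0$ and suppose in addition that $F_{r'}$ extends to a function that is continuous on the closed strip $|\mathrm{Im}\,z|\le\rho/\sigma'$ and analytic in the open strip $\mathcal S_{\rho/\sigma'}=\{|\mathrm{Im}\,z|<\rho/\sigma'\}$, that there are constants $\mathcal K>0$ and $\sigma_0\in\mathbb R$ with $|e^{z^2/2}F_{r'}(z)|\le\mathcal K|z|^{\sigma_0}$ for all $z$ in the open strip with $|z|$ sufficiently large, and that $$\int_{\partial\mathcal S_{\rho/\sigma'}}|e^{z^2/2}F_{r'}(z)|\,|\mathrm dz|<\infty .$$ Then there is a constant $C_{r'}$, independent of $N$, such that for every $N\ge1$ $$\|\psi_\infty-\psi_{N,r'}\|_2\le C_{r'}\exp\!\left(-\frac{\rho}{\sigma'}\sqrt{2(N-1)}\right).$$ In this case a cutoff $N=\mathcal O\!\left(e^{2r'}\log^2\frac1\varepsilon\right)$ suffices for accuracy $\varepsilon$,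 in the following sense: for every constant $\kappa>\frac1{2\rho^2}$ there is $\varepsilon_0>0$ such that $\|\psi_\infty-\psi_{N,r'}\|_2\le\varepsilon$ for all $\varepsilon\in(0,\varepsilon_0)$ and all integers $N\ge\kappa\,e^{2r'}\log^2\frac1\varepsilon$. -/

import Mathlib

open MeasureTheory Filter Topology Asymptotics

noncomputable section

/-- The physicists' Hermite polynomials `H_n`, i.e.
`H_n(y) = (-1)^n e^{y^2} (d/dy)^n e^{-y^2}`, through `H_0 = 1`, `H_{n+1} = 2 y H_n - H_n'`. -/
def physHermitePoly : ℕ → Polynomial ℝ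
  | 0 => 1
  | n + 1 => 2 * Polynomial.X * physHermitePoly n - Polynomial.derivative (physHermitePoly n)

/-- The normalized Hermite function
`h_n(y) = π^{-1/4} (2^n n!)^{-1/2} H_n(y) e^{-y^2/2}`. -/
def normHermiteFun (n : ℕ) (y : ℝ) : ℝ :=
  Real.pi ^ (-(1 / 4) : ℝ) * (2 ^ n * (n.factorial : ℝ)) ^ (-(1 / 2) : ℝ) *
    (physHermitePoly n).eval y * Real.exp (-y ^ 2 / 2)

/-- The squeezed Fock basis function
`φ_{n,r'}(x) = (√2 σ')^{-1/2} h_n(x / (√2 σ'))` with `σ' = e^{r'}`. -/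
def squeezedFock (r' : ℝ) (n : ℕ) (x : ℝ) : ℂ :=
  ((1 / √(√2 * Real.exp r') * normHermiteFun n (x / (√2 * Real.exp r')) : ℝ) : ℂ)

theorem integrable_poly_mul_gaussian (p : Polynomial ℝ) :
    Integrable (fun y : ℝ => p.eval y * Real.exp (-y ^ 2)) volume := by
  induction p using Polynomial.induction_on' with
  | add p q hp hq =>
    refine (hp.add hq).congr (Eventually.of_forall fun y => ?_)
    simp [add_mul]
  | monomial k a =>
    have h := (integrable_rpow_mul_exp_neg_mul_sq (b := 1) one_pos
      (s := (k : ℝ)) (by have := Nat.cast_nonneg (α := ℝ) k; linarith)).const_mul a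
    refine h.congr (Eventually.of_forall fun y => ?_)
    simp [Real.rpow_natCast, mul_assoc]

theorem memLp_normHermiteFun (n : ℕ) : MemLp (normHermiteFun n) 2 volume := by
  have hc : Continuous (normHermiteFun n) := by
    unfold normHermiteFun
    fun_prop
  rw [memLp_two_iff_integrable_sq hc.aestronglyMeasurable]
  have h := (integrable_poly_mul_gaussian ((physHermitePoly n) ^ 2)).const_mul
    ((Real.pi ^ (-(1 / 4) : ℝ) * (2 ^ n * (n.factorial : ℝ)) ^ (-(1 / 2) : ℝ)) ^ 2)
  refine h.congr (Eventually.of_forall fun y => ?_)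
  have e : Real.exp (-y ^ 2) = Real.exp (-y ^ 2 / 2) ^ 2 := by
    rw [← Real.exp_nat_mul]; congr 1; push_cast; ring
  simp only [normHermiteFun, Polynomial.eval_pow, e]
  ring

theorem memLp_squeezedFock (r' : ℝ) (n : ℕ) : MemLp (squeezedFock r' n) 2 volume := by
  have hs : √2 * Real.exp r' ≠ 0 := by positivity
  have hc : Continuous (normHermiteFun n) := by
    unfold normHermiteFun
    fun_prop
  have h1 : MemLp (fun x : ℝ => normHermiteFun n (x / (√2 * Real.exp r'))) 2 volume := by
    rw [memLp_two_iff_integrable_sq (by fun_prop)]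
    exact (((memLp_two_iff_integrable_sq hc.aestronglyMeasurable).1
      (memLp_normHermiteFun n)).comp_div hs)
  exact (h1.const_mul (1 / √(√2 * Real.exp r'))).ofReal

/-- The squeezed Fock basis function as an element of `L²(ℝ)`. -/
def squeezedFockL2 (r' : ℝ) (n : ℕ) : Lp ℂ 2 (volume : Measure ℝ) :=
  (memLp_squeezedFock r' n).toLp (squeezedFock r' n)

/-- The subspace of `L²(ℝ)` spanned by `φ_{0,r'}, …, φ_{N-1,r'}`. -/
def squeezedFockSpace (r' : ℝ) (N : ℕ) : Submodule ℂ (Lp ℂ 2 (volume : Measure ℝ)) :=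
  Submodule.span ℂ (Set.range fun n : Fin N => squeezedFockL2 r' n)

instance squeezedFockSpace_finiteDimensional (r' : ℝ) (N : ℕ) :
    FiniteDimensional ℂ (squeezedFockSpace r' N) :=
  FiniteDimensional.span_of_finite ℂ (Set.finite_range _)

/-- The truncation `ψ_{N,r'}`: the orthogonal projection of `ψ` onto the span of the first `N`
squeezed Fock basis functions. -/
def squeezedFockTrunc (r' : ℝ) (N : ℕ) (ψ : Lp ℂ 2 (volume : Measure ℝ)) :
    Lp ℂ 2 (volume : Measure ℝ) :=
  (squeezedFockSpace r' N).starProjection ψ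

/-- The ideal kernel state `ψ_∞ = 𝒩 g`. -/
def idealKernelState (𝒩 : ℂ) (g : ℝ → ℂ) (x : ℝ) : ℂ := 𝒩 * g x

/-- The rescaled target `F_{r'}(y) = (√2 σ')^{1/2} ψ(√2 σ' y)` with `σ' = e^{r'}`. The dilation is
the one that turns `φ_{n,r'}` into the Hermite function `h_n`. -/
def rescaledTarget (r' : ℝ) (ψ : ℝ → ℂ) (y : ℝ) : ℂ :=
  (√(√2 * Real.exp r') : ℝ) * ψ (√2 * Real.exp r' * y)

/-- The annihilation operator `𝒜 = (y + d/dy) / √2`. -/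
def annihilationOp (F : ℝ → ℂ) (y : ℝ) : ℂ :=
  (1 / √2 : ℝ) * ((y : ℂ) * F y + deriv F y)

/-- The strip-analyticity assumption on `F` with half-width `a`: `F` is the restriction to `ℝ` of a
function `Fc` which is continuous on the closed strip `|Im z| ≤ a` and analytic inside it, such that
`|e^{z²/2} Fc(z)| ≤ K |z|^{σ₀}` as `|z| → ∞` within the strip, and such that the integral of
`|e^{z²/2} Fc(z)|` over the two boundary lines is finite. -/
def StripAnalyticWeighted (a : ℝ) (F : ℝ → ℂ) : Prop :=
  ∃ Fc : ℂ → ℂ,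
    (∀ y : ℝ, Fc y = F y) ∧
    DifferentiableOn ℂ Fc {z : ℂ | |z.im| < a} ∧
    ContinuousOn Fc {z : ℂ | |z.im| ≤ a} ∧
    (∃ K > (0 : ℝ), ∃ σ₀ R : ℝ, ∀ z : ℂ, |z.im| < a → R ≤ ‖z‖ →
      ‖Complex.exp (z ^ 2 / 2) * Fc z‖ ≤ K * ‖z‖ ^ σ₀) ∧
    Integrable (fun x : ℝ =>
      Complex.exp (((x : ℂ) + a * Complex.I) ^ 2 / 2) * Fc ((x : ℂ) + a * Complex.I)) volume ∧
    Integrable (fun x : ℝ =>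
      Complex.exp (((x : ℂ) - a * Complex.I) ^ 2 / 2) * Fc ((x : ℂ) - a * Complex.I)) volume

end

/-!
The coefficients of `ψ` in the squeezed Fock basis are the Hermite coefficients `c_n = ∫ h_n F` of
the rescaled target `F`, and since the Hermite functions form a Hilbert basis
(`squeezedFockBasis`), the squared truncation error is the tail `∑_{n ≥ N} |c_n|²`
(`hasSum_norm_sub_squeezedFockTrunc`). Orthonormality follows from the ladder relations, and
completeness from the injectivity of the Fourier transform: a function orthogonal to all `h_n` has,
after multiplication by `h_0`, vanishing moments.

Algebraic rates: integration by parts gives `√(n+1) c_{n+1}(F) = c_n(𝒜 F)`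
(`sqrt_mul_hermiteCoeff_succ`). Iterating `s` times expresses the tail of `F` through coefficients
of `𝒜^s F`, with weights at most `1 / (N (N-1) ⋯ (N-s+1))`, and Bessel's inequality concludes.

Exponential rates: put `G(z) = e^{z²/2} F(z)`, so that `c_n` is a multiple of
`∫ H_n(y) e^{-y²} G(y) dy`. Inserting `2√π H_n(y) e^{-y²} = ∫ (-it)^n e^{-t²/4} e^{ity} dt`
(`integral_hermiteWeight`) turns this into an integral over `t` of the Fourier transform of `G`,
which is `O(e^{-a|t|})` after a shift of the contour to the boundary of the strip of half-width `a`,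
where `G` is integrable. As `G` need not be integrable on `ℝ` itself, `G` is first multiplied by
`e^{-δz²}`, and `δ → 0` at the end; no decay of `G` is needed and all `n` are treated alike. The
saddle point `t = √(2n)` of `|t|^n e^{-t²/4}` and Stirling's formula
give `|c_n| = O(n^{-1/4} e^{-a√(2n)})` (`exists_norm_hermiteCoeff_sq_le`), and the squares of these
bounds are dominated by increments of `e^{-2a√(2n)}`, so that the tail telescopes
(`norm_le_of_hasSum_coeff`).
-/

noncomputable section

/-! ### Hermite functions and the ladder relation -/

theorem derivative_physHermitePoly_succ (n : ℕ) :
    Polynomial.derivative (physHermitePoly (n + 1)) =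
      (2 * ((n : ℝ) + 1)) • physHermitePoly n := by
  induction n with
  | zero =>
    simp only [physHermitePoly, Polynomial.smul_eq_C_mul]
    simp
    rfl
  | succ n ih =>
    have h : physHermitePoly (n + 1 + 1) = 2 * Polynomial.X * physHermitePoly (n + 1) -
      Polynomial.derivative (physHermitePoly (n + 1)) := rfl
    have h' : physHermitePoly (n + 1) = 2 * Polynomial.X * physHermitePoly n -
      Polynomial.derivative (physHermitePoly n) := rfl
    rw [h, ih]
    simp only [Polynomial.derivative_sub, Polynomial.derivative_mul, Polynomial.derivative_smul,
      Polynomial.derivative_ofNat, Polynomial.derivative_X, ih]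
    simp only [Polynomial.smul_eq_C_mul]
    push_cast
    simp only [map_mul, map_add, map_ofNat, map_one, map_natCast]
    rw [h']
    ring

/-- The normalizing constant `π^{-1/4} (2^n n!)^{-1/2}` of the `n`-th Hermite function. -/
def hermiteNorm (n : ℕ) : ℝ :=
  Real.pi ^ (-(1 / 4) : ℝ) * (2 ^ n * (n.factorial : ℝ)) ^ (-(1 / 2) : ℝ)

theorem hermiteNorm_pos (n : ℕ) : 0 < hermiteNorm n := by
  unfold hermiteNorm
  have := Real.pi_pos
  positivity

theorem sqrt_mul_hermiteNorm_succ (n : ℕ) :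
    √(2 * ((n : ℝ) + 1)) * hermiteNorm (n + 1) = hermiteNorm n := by
  have h : (2 ^ (n + 1) * ((n + 1).factorial : ℝ)) =
      (2 * ((n : ℝ) + 1)) * (2 ^ n * (n.factorial : ℝ)) := by
    rw [Nat.factorial_succ]; push_cast; ring
  unfold hermiteNorm
  rw [h, Real.mul_rpow (by positivity) (by positivity), Real.sqrt_eq_rpow]
  have : (2 * ((n : ℝ) + 1)) ^ (1 / 2 : ℝ) * (2 * ((n : ℝ) + 1)) ^ (-(1 / 2) : ℝ) = 1 := by
    rw [← Real.rpow_add (by positivity)]; simp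
  linear_combination (Real.pi ^ (-(1 / 4) : ℝ) * (2 ^ n * (n.factorial : ℝ)) ^ (-(1 / 2) : ℝ)) * this

theorem normHermiteFun_eq (n : ℕ) (y : ℝ) : normHermiteFun n y =
    hermiteNorm n * (physHermitePoly n).eval y * Real.exp (-y ^ 2 / 2) := rfl

@[fun_prop]
theorem continuous_normHermiteFun (n : ℕ) : Continuous (normHermiteFun n) := by
  unfold normHermiteFun
  fun_prop

theorem physHermitePoly_succ_eval (n : ℕ) (y : ℝ) : (physHermitePoly (n + 1)).eval y =
    2 * y * (physHermitePoly n).eval y - (Polynomial.derivative (physHermitePoly n)).eval y := by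
  simp [physHermitePoly]

theorem hasDerivAt_normHermiteFun_aux (n : ℕ) (y : ℝ) : HasDerivAt (normHermiteFun n)
    (hermiteNorm n * ((Polynomial.derivative (physHermitePoly n)).eval y -
      y * (physHermitePoly n).eval y) * Real.exp (-y ^ 2 / 2)) y := by
  have h1 := (physHermitePoly n).hasDerivAt y
  have h2 : HasDerivAt (fun y : ℝ => -y ^ 2 / 2) (-y) y := by
    have := ((hasDerivAt_pow 2 y).neg).div_const 2
    convert! this using 1
    push_cast
    ring
  convert! ((h1.const_mul (hermiteNorm n)).mul h2.exp) using 1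
  ring

/-- The raising relation `y h_n - h_n' = √(2(n+1)) h_{n+1}`, as a formula for `h_n'`. -/
theorem hasDerivAt_normHermiteFun (n : ℕ) (y : ℝ) : HasDerivAt (normHermiteFun n)
    (y * normHermiteFun n y - √(2 * ((n : ℝ) + 1)) * normHermiteFun (n + 1) y) y := by
  convert hasDerivAt_normHermiteFun_aux n y using 1
  simp only [normHermiteFun_eq, physHermitePoly_succ_eval]
  linear_combination (-((2 * y * (physHermitePoly n).eval y -
    (Polynomial.derivative (physHermitePoly n)).eval y)) * Real.exp (-y ^ 2 / 2)) *
    sqrt_mul_hermiteNorm_succ n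

/-- The lowering relation `y h_{n+1} + h_{n+1}' = √(2(n+1)) h_n`, as a formula for `h_{n+1}'`. -/
theorem hasDerivAt_normHermiteFun_succ (n : ℕ) (y : ℝ) : HasDerivAt (normHermiteFun (n + 1))
    (√(2 * ((n : ℝ) + 1)) * normHermiteFun n y - y * normHermiteFun (n + 1) y) y := by
  convert hasDerivAt_normHermiteFun_aux (n + 1) y using 1
  simp only [normHermiteFun_eq, derivative_physHermitePoly_succ, Polynomial.eval_smul, smul_eq_mul]
  have h := Real.mul_self_sqrt (show (0 : ℝ) ≤ 2 * ((n : ℝ) + 1) by positivity)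
  have h' := sqrt_mul_hermiteNorm_succ n
  rw [← h']
  linear_combination (hermiteNorm (n + 1) * (physHermitePoly n).eval y *
    Real.exp (-y ^ 2 / 2)) * h

theorem hasDerivAt_normHermiteFun_zero (y : ℝ) : HasDerivAt (normHermiteFun 0)
    (-(y * normHermiteFun 0 y)) y := by
  convert hasDerivAt_normHermiteFun_aux 0 y using 1
  simp only [normHermiteFun_eq, physHermitePoly, Polynomial.derivative_one, Polynomial.eval_zero]
  ring

/-- The three-term recurrence, from the two ladder relations. -/
theorem mul_normHermiteFun_succ (n : ℕ) (y : ℝ) : 2 * (y * normHermiteFun (n + 1) y) =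
    √(2 * ((n : ℝ) + 1)) * normHermiteFun n y +
      √(2 * ((n : ℝ) + 1 + 1)) * normHermiteFun (n + 2) y := by
  have h := (hasDerivAt_normHermiteFun (n + 1) y).unique (hasDerivAt_normHermiteFun_succ n y)
  push_cast at h
  linarith

theorem mul_normHermiteFun_zero (y : ℝ) :
    2 * (y * normHermiteFun 0 y) = √2 * normHermiteFun 1 y := by
  have h := (hasDerivAt_normHermiteFun 0 y).unique (hasDerivAt_normHermiteFun_zero y)
  simp at h
  linarith

theorem memLp_mul_normHermiteFun (n : ℕ) :
    MemLp (fun y => y * normHermiteFun n y) 2 volume := by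
  rcases n with _ | n
  · convert! (memLp_normHermiteFun 1).const_mul (√2 / 2) using 2 with y
    linarith [mul_normHermiteFun_zero y]
  · convert! ((memLp_normHermiteFun n).const_mul (√(2 * ((n : ℝ) + 1)) / 2)).add
      ((memLp_normHermiteFun (n + 2)).const_mul (√(2 * ((n : ℝ) + 1 + 1)) / 2)) using 2 with y
    simp only [Pi.add_apply]
    linarith [mul_normHermiteFun_succ n y]

/-! ### Hermite coefficients and orthonormality -/

/-- The Hermite coefficient `∫ h_n v` of a function `v`; as `h_n` is real, this is `⟨h_n, v⟩`. -/
def hermiteCoeff (n : ℕ) (v : ℝ → ℂ) : ℂ := ∫ y, (normHermiteFun n y : ℂ) * v y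

theorem integrable_normHermiteFun_mul (n : ℕ) {v : ℝ → ℂ} (hv : MemLp v 2 volume) :
    Integrable (fun y => (normHermiteFun n y : ℂ) * v y) volume :=
  (memLp_normHermiteFun n).ofReal.integrable_mul hv

theorem integrable_mul_normHermiteFun_mul (n : ℕ) {v : ℝ → ℂ} (hv : MemLp v 2 volume) :
    Integrable (fun y => ((y * normHermiteFun n y : ℝ) : ℂ) * v y) volume :=
  (memLp_mul_normHermiteFun n).ofReal.integrable_mul hv

/-- Adjointness of the ladder operators: `√(n+1) ⟨h_{n+1}, v⟩ = ⟨h_n, 𝒜 v⟩`, by integration by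
parts. -/
theorem sqrt_mul_hermiteCoeff_succ (n : ℕ) {v : ℝ → ℂ} (hd : Differentiable ℝ v)
    (hv : MemLp v 2 volume) (hv' : MemLp (deriv v) 2 volume) :
    (√((n : ℝ) + 1) : ℂ) * hermiteCoeff (n + 1) v = hermiteCoeff n (annihilationOp v) := by
  have hu : ∀ y : ℝ, HasDerivAt (fun y => (normHermiteFun n y : ℂ))
      (((y * normHermiteFun n y - √(2 * ((n : ℝ) + 1)) * normHermiteFun (n + 1) y : ℝ)) : ℂ) y :=
    fun y => (hasDerivAt_normHermiteFun n y).ofReal_comp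
  have i1 := integrable_mul_normHermiteFun_mul n hv
  have i2 := (integrable_normHermiteFun_mul (n + 1) hv).const_mul (√(2 * ((n : ℝ) + 1)) : ℂ)
  have i3 := integrable_normHermiteFun_mul n hv'
  have ibp := integral_mul_deriv_eq_deriv_mul_of_integrable (u := fun y => (normHermiteFun n y : ℂ))
    (v := v) (v' := deriv v) (fun y _ => hu y) (fun y _ => (hd y).hasDerivAt) i3
    ((i1.sub i2).congr (Eventually.of_forall fun y => by simp; ring))
    (integrable_normHermiteFun_mul n hv)
  have e1 : ∫ y, (((y * normHermiteFun n y - √(2 * ((n : ℝ) + 1)) * normHermiteFun (n + 1) y : ℝ)) : ℂ)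
      * v y = (∫ y, ((y * normHermiteFun n y : ℝ) : ℂ) * v y) -
        (√(2 * ((n : ℝ) + 1)) : ℂ) * hermiteCoeff (n + 1) v := by
    rw [hermiteCoeff, ← integral_const_mul, ← integral_sub i1 i2]
    congr 1 with y
    push_cast; ring
  have e2 : hermiteCoeff n (annihilationOp v) = (1 / √2 : ℝ) *
      ((∫ y, ((y * normHermiteFun n y : ℝ) : ℂ) * v y) +
        ∫ y, (normHermiteFun n y : ℂ) * deriv v y) := by
    rw [hermiteCoeff, ← integral_add i1 i3, ← integral_const_mul]
    congr 1 with y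
    simp only [annihilationOp]
    push_cast; ring
  rw [e1] at ibp
  rw [e2, ibp, Real.sqrt_mul (by norm_num)]
  have : (√2 : ℂ) ≠ 0 := by norm_cast; positivity
  push_cast
  field_simp
  ring

theorem annihilationOp_normHermiteFun_zero :
    annihilationOp (fun y => (normHermiteFun 0 y : ℂ)) = fun _ => 0 := by
  ext y
  rw [annihilationOp, (hasDerivAt_normHermiteFun_zero y).ofReal_comp.deriv]
  simp

theorem annihilationOp_normHermiteFun_succ (n : ℕ) :
    annihilationOp (fun y => (normHermiteFun (n + 1) y : ℂ)) =
      fun y => (√((n : ℝ) + 1) : ℂ) * normHermiteFun n y := by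
  ext y
  rw [annihilationOp, (hasDerivAt_normHermiteFun_succ n y).ofReal_comp.deriv,
    Real.sqrt_mul (by norm_num)]
  have : (√2 : ℂ) ≠ 0 := by norm_cast; positivity
  push_cast
  field_simp
  ring

theorem sqrt_mul_hermiteCoeff_succ_normHermiteFun (n m : ℕ) :
    (√((n : ℝ) + 1) : ℂ) * hermiteCoeff (n + 1) (fun y => (normHermiteFun m y : ℂ)) =
      hermiteCoeff n (annihilationOp (fun y => (normHermiteFun m y : ℂ))) := by
  have hd : ∀ y, HasDerivAt (fun y => (normHermiteFun m y : ℂ)) _ y :=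
    fun y => (hasDerivAt_normHermiteFun m y).ofReal_comp
  refine sqrt_mul_hermiteCoeff_succ n (fun y => (hd y).differentiableAt)
    (memLp_normHermiteFun m).ofReal ?_
  rw [deriv_eq hd]
  exact ((memLp_mul_normHermiteFun m).sub
    ((memLp_normHermiteFun (m + 1)).const_mul _)).ofReal

theorem hermiteCoeff_zero_zero : hermiteCoeff 0 (fun y => (normHermiteFun 0 y : ℂ)) = 1 := by
  have h : ∀ y : ℝ, (normHermiteFun 0 y : ℂ) * normHermiteFun 0 y =
      ((Real.pi ^ (-(1 / 2) : ℝ) * Real.exp (-1 * y ^ 2) : ℝ) : ℂ) := by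
    intro y
    rw [← Complex.ofReal_mul]
    congr 1
    have e : Real.exp (-1 * y ^ 2) = Real.exp (-y ^ 2 / 2) * Real.exp (-y ^ 2 / 2) := by
      rw [← Real.exp_add]; congr 1; ring
    have e' : Real.pi ^ (-(1 / 2) : ℝ) = Real.pi ^ (-(1 / 4) : ℝ) * Real.pi ^ (-(1 / 4) : ℝ) := by
      rw [← Real.rpow_add Real.pi_pos]; norm_num
    rw [e, e']
    simp [normHermiteFun, physHermitePoly]
    ring
  rw [hermiteCoeff]
  simp_rw [h]
  rw [integral_complex_ofReal, integral_const_mul, integral_gaussian, div_one, Real.sqrt_eq_rpow,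
    ← Real.rpow_add Real.pi_pos]
  norm_num

theorem hermiteCoeff_comm (n m : ℕ) : hermiteCoeff n (fun y => (normHermiteFun m y : ℂ)) =
    hermiteCoeff m (fun y => (normHermiteFun n y : ℂ)) := by
  simp only [hermiteCoeff, mul_comm]

theorem hermiteCoeff_const_mul (n : ℕ) (c : ℂ) (v : ℝ → ℂ) :
    hermiteCoeff n (fun y => c * v y) = c * hermiteCoeff n v := by
  simp only [hermiteCoeff, ← integral_const_mul]
  congr 1 with y
  ring

theorem hermiteCoeff_succ_zero (n : ℕ) :
    hermiteCoeff (n + 1) (fun y => (normHermiteFun 0 y : ℂ)) = 0 := by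
  have h := sqrt_mul_hermiteCoeff_succ_normHermiteFun n 0
  rw [annihilationOp_normHermiteFun_zero] at h
  have h0 : (√((n : ℝ) + 1) : ℂ) ≠ 0 := by norm_cast; positivity
  simpa [hermiteCoeff, h0] using h

/-- Orthonormality of the Hermite functions, by induction with the ladder operators. -/
theorem hermiteCoeff_normHermiteFun (n m : ℕ) :
    hermiteCoeff n (fun y => (normHermiteFun m y : ℂ)) = if n = m then 1 else 0 := by
  induction n generalizing m with
  | zero =>
    rcases m with _ | m
    · simpa using hermiteCoeff_zero_zero
    · rw [hermiteCoeff_comm, hermiteCoeff_succ_zero]; simp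
  | succ n ih =>
    rcases m with _ | m
    · rw [hermiteCoeff_succ_zero]; simp
    · have h := sqrt_mul_hermiteCoeff_succ_normHermiteFun n (m + 1)
      rw [annihilationOp_normHermiteFun_succ, hermiteCoeff_const_mul, ih] at h
      have h0 : (√((n : ℝ) + 1) : ℂ) ≠ 0 := by norm_cast; positivity
      apply mul_left_cancel₀ h0
      rw [h]
      by_cases hnm : n = m <;> simp [hnm]

/-! ### Completeness of the Hermite functions -/

open scoped FourierTransform ContDiff in
/-- The Fourier transform is injective on `L¹(ℝ)`. -/
theorem ae_eq_zero_of_fourier_eq_zero {f : ℝ → ℂ} (hf : Integrable f volume)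
    (h : ∀ ξ : ℝ, ∫ x : ℝ, Complex.exp (ξ * x * Complex.I) * f x = 0) : ∀ᵐ x, f x = 0 := by
  have hF : 𝓕 f = 0 := by
    ext ξ
    rw [Real.fourier_eq']
    simp only [smul_eq_mul, Pi.zero_apply]
    rw [← h (-2 * Real.pi * ξ)]
    congr 1 with x
    congr 2
    simp
    ring
  apply ae_eq_zero_of_integral_contDiff_smul_eq_zero hf.locallyIntegrable
  intro g g_smooth g_cpt
  have hg₁ : HasCompactSupport (Complex.ofRealCLM ∘ g) := g_cpt.comp_left rfl
  have hg₂ : ContDiff ℝ ∞ (Complex.ofRealCLM ∘ g) := by fun_prop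
  set G : SchwartzMap ℝ ℂ := hg₁.toSchwartzMap hg₂ with hG
  have hGF : 𝓕 (𝓕⁻ G) = G := by simp
  have key := VectorFourier.integral_fourierIntegral_smul_eq_flip (L := innerₗ ℝ)
    (f := (𝓕⁻ G : SchwartzMap ℝ ℂ)) (g := f) (μ := volume) (ν := volume)
    Real.continuous_fourierChar continuous_inner (𝓕⁻ G : SchwartzMap ℝ ℂ).integrable hf
  calc ∫ x, g x • f x = ∫ x, G x • f x := by
        congr 1 with x
    _ = ∫ x, (𝓕 (𝓕⁻ G) : SchwartzMap ℝ ℂ) x • f x := by rw [hGF]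
    _ = ∫ x, (𝓕⁻ G : SchwartzMap ℝ ℂ) x • 𝓕 f x := by
        rw [SchwartzMap.fourier_coe]
        simpa [flip_innerₗ] using! key
    _ = 0 := by simp [hF]

theorem memLp_pow_mul_normHermiteFun (k n : ℕ) :
    MemLp (fun y => y ^ k * normHermiteFun n y) 2 volume := by
  induction k generalizing n with
  | zero => simpa using memLp_normHermiteFun n
  | succ k ih =>
    rcases n with _ | n
    · convert! (ih 1).const_mul (√2 / 2) using 2 with y
      linear_combination (y ^ k / 2) * mul_normHermiteFun_zero y
    · convert! ((ih n).const_mul (√(2 * ((n : ℝ) + 1)) / 2)).add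
        ((ih (n + 2)).const_mul (√(2 * ((n : ℝ) + 1 + 1)) / 2)) using 2 with y
      simp only [Pi.add_apply]
      linear_combination (y ^ k / 2) * mul_normHermiteFun_succ n y

theorem integral_pow_mul_normHermiteFun_mul_eq_zero {v : ℝ → ℂ} (hv : MemLp v 2 volume)
    (h : ∀ n, hermiteCoeff n v = 0) (k n : ℕ) :
    ∫ y, ((y ^ k * normHermiteFun n y : ℝ) : ℂ) * v y = 0 := by
  have hi : ∀ k n, Integrable (fun y => ((y ^ k * normHermiteFun n y : ℝ) : ℂ) * v y) volume :=
    fun k n => (memLp_pow_mul_normHermiteFun k n).ofReal.integrable_mul hv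
  induction k generalizing n with
  | zero => simpa [hermiteCoeff] using h n
  | succ k ih =>
    rcases n with _ | n
    · have e : ∀ y : ℝ, ((y ^ (k + 1) * normHermiteFun 0 y : ℝ) : ℂ) * v y =
          (√2 / 2 : ℝ) * (((y ^ k * normHermiteFun 1 y : ℝ) : ℂ) * v y) := by
        intro y
        have := congrArg (fun x : ℝ => (x : ℂ)) (mul_normHermiteFun_zero y)
        push_cast at this ⊢
        linear_combination (y ^ k / 2 * v y) * this
      simp_rw [e]
      rw [integral_const_mul, ih, mul_zero]
    · have e : ∀ y : ℝ, ((y ^ (k + 1) * normHermiteFun (n + 1) y : ℝ) : ℂ) * v y =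
          (√(2 * ((n : ℝ) + 1)) / 2 : ℝ) * (((y ^ k * normHermiteFun n y : ℝ) : ℂ) * v y) +
          (√(2 * ((n : ℝ) + 1 + 1)) / 2 : ℝ) *
            (((y ^ k * normHermiteFun (n + 2) y : ℝ) : ℂ) * v y) := by
        intro y
        have := congrArg (fun x : ℝ => (x : ℂ)) (mul_normHermiteFun_succ n y)
        push_cast at this ⊢
        linear_combination (y ^ k / 2 * v y) * this
      simp_rw [e]
      rw [integral_add ((hi k n).const_mul _) ((hi k (n + 2)).const_mul _), integral_const_mul,
        integral_const_mul, ih, ih, mul_zero, mul_zero, add_zero]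

theorem normHermiteFun_zero_eq (y : ℝ) :
    normHermiteFun 0 y = hermiteNorm 0 * Real.exp (-y ^ 2 / 2) := by
  simp [normHermiteFun_eq, physHermitePoly]

theorem exp_abs_mul_normHermiteFun_zero_le (t y : ℝ) :
    Real.exp |t * y| * normHermiteFun 0 y ≤
      hermiteNorm 0 * Real.exp (t ^ 2) * Real.exp (-(1 / 4) * y ^ 2) := by
  have h : Real.exp |t * y| * Real.exp (-y ^ 2 / 2) ≤
      Real.exp (t ^ 2) * Real.exp (-(1 / 4) * y ^ 2) := by
    rw [← Real.exp_add, ← Real.exp_add, Real.exp_le_exp, abs_mul]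
    nlinarith [sq_nonneg (|t| - |y| / 2), sq_abs t, sq_abs y]
  rw [normHermiteFun_zero_eq]
  nlinarith [hermiteNorm_pos 0]

theorem memLp_exp_neg_mul_sq {b : ℝ} (hb : 0 < b) :
    MemLp (fun y : ℝ => Real.exp (-b * y ^ 2)) 2 volume := by
  rw [memLp_two_iff_integrable_sq (by fun_prop)]
  refine (integrable_exp_neg_mul_sq (b := 2 * b) (by positivity)).congr
    (Eventually.of_forall fun y => ?_)
  simp only
  rw [← Real.exp_nat_mul]
  congr 1
  push_cast
  ring

theorem norm_exp_partial_sum_le (z : ℂ) (m : ℕ) :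
    ‖∑ k ∈ Finset.range m, z ^ k / (k.factorial : ℂ)‖ ≤ Real.exp ‖z‖ := by
  refine (norm_sum_le _ _).trans ?_
  refine le_trans (le_of_eq ?_) (Real.sum_le_exp_of_nonneg (norm_nonneg z) m)
  exact Finset.sum_congr rfl fun k _ => by simp

/-- Completeness of the Hermite functions: the vanishing of all coefficients kills all moments of
the integrable function `h_0 v`, hence its Fourier transform. -/
theorem ae_eq_zero_of_hermiteCoeff_eq_zero {v : ℝ → ℂ} (hv : MemLp v 2 volume)
    (h : ∀ n, hermiteCoeff n v = 0) : ∀ᵐ y, v y = 0 := by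
  have hw : Integrable (fun y => (normHermiteFun 0 y : ℂ) * v y) volume :=
    integrable_normHermiteFun_mul 0 hv
  have key : ∀ᵐ y, (normHermiteFun 0 y : ℂ) * v y = 0 := by
    refine ae_eq_zero_of_fourier_eq_zero hw fun t => ?_
    have hlim : Tendsto (fun m : ℕ => ∫ y : ℝ,
        (∑ k ∈ Finset.range m, (t * y * Complex.I) ^ k / (k.factorial : ℂ)) *
          ((normHermiteFun 0 y : ℂ) * v y)) atTop
        (𝓝 (∫ y : ℝ, Complex.exp (t * y * Complex.I) * ((normHermiteFun 0 y : ℂ) * v y))) := by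
      refine tendsto_integral_of_dominated_convergence
        (fun y => hermiteNorm 0 * Real.exp (t ^ 2) * (Real.exp (-(1 / 4) * y ^ 2) * ‖v y‖))
        (fun m => ?_) ?_ (fun m => ?_) ?_
      · exact (Continuous.aestronglyMeasurable (by fun_prop)).mul hw.aestronglyMeasurable
      · exact ((memLp_exp_neg_mul_sq (by norm_num : (0 : ℝ) < 1 / 4)).integrable_mul
          hv.norm).const_mul _
      · refine Eventually.of_forall fun y => ?_
        have h0 : 0 ≤ normHermiteFun 0 y := by
          rw [normHermiteFun_zero_eq]
          have := hermiteNorm_pos 0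
          positivity
        have h1 := norm_exp_partial_sum_le (t * y * Complex.I) m
        have h2 : ‖(t * y * Complex.I : ℂ)‖ = |t * y| := by
          rw [norm_mul, Complex.norm_I, mul_one, ← Complex.ofReal_mul, Complex.norm_real,
            Real.norm_eq_abs]
        rw [h2] at h1
        rw [norm_mul, norm_mul, Complex.norm_real, Real.norm_of_nonneg h0]
        calc _ ≤ Real.exp |t * y| * (normHermiteFun 0 y * ‖v y‖) := by gcongr
          _ = (Real.exp |t * y| * normHermiteFun 0 y) * ‖v y‖ := by ring
          _ ≤ (hermiteNorm 0 * Real.exp (t ^ 2) * Real.exp (-(1 / 4) * y ^ 2)) * ‖v y‖ :=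
            mul_le_mul_of_nonneg_right (exp_abs_mul_normHermiteFun_zero_le t y) (norm_nonneg _)
          _ = _ := by ring
      · refine Eventually.of_forall fun y => ?_
        have := (NormedSpace.expSeries_div_hasSum_exp (𝔸 := ℂ) (t * y * Complex.I)).tendsto_sum_nat
        rw [← Complex.exp_eq_exp_ℂ] at this
        exact this.mul_const _
    have hz : ∀ m : ℕ, ∫ y : ℝ,
        (∑ k ∈ Finset.range m, (t * y * Complex.I) ^ k / (k.factorial : ℂ)) *
          ((normHermiteFun 0 y : ℂ) * v y) = 0 := by
      intro m
      have e : ∀ y : ℝ, (∑ k ∈ Finset.range m, (t * y * Complex.I) ^ k / (k.factorial : ℂ)) *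
          ((normHermiteFun 0 y : ℂ) * v y) = ∑ k ∈ Finset.range m,
          ((t * Complex.I) ^ k / (k.factorial : ℂ)) *
            (((y ^ k * normHermiteFun 0 y : ℝ) : ℂ) * v y) := by
        intro y
        rw [Finset.sum_mul]
        refine Finset.sum_congr rfl fun k _ => ?_
        push_cast
        ring
      simp_rw [e]
      rw [integral_finsetSum]
      · refine Finset.sum_eq_zero fun k _ => ?_
        rw [integral_const_mul, integral_pow_mul_normHermiteFun_mul_eq_zero hv h, mul_zero]
      · exact fun k _ => ((memLp_pow_mul_normHermiteFun k 0).ofReal.integrable_mul hv).const_mul _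
    simp_rw [hz] at hlim
    exact (tendsto_nhds_unique hlim tendsto_const_nhds)
  filter_upwards [key] with y hy
  have h0 : normHermiteFun 0 y ≠ 0 := by
    rw [normHermiteFun_zero_eq]
    have := hermiteNorm_pos 0
    positivity
  simpa [h0] using hy

/-! ### The squeezed Fock basis -/

/-- The squeezed Fock coefficients of `f` are the Hermite coefficients of the rescaled `f`. -/
theorem inner_squeezedFockL2 (r : ℝ) (n : ℕ) {f : ℝ → ℂ} (hf : MemLp f 2 volume) :
    inner ℂ (squeezedFockL2 r n) (hf.toLp f) = hermiteCoeff n (rescaledTarget r f) := by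
  set l : ℝ := √2 * Real.exp r with hl
  have hl0 : 0 < l := by positivity
  have h1 : inner ℂ (squeezedFockL2 r n) (hf.toLp f) =
      ∫ x : ℝ, (fun y : ℝ => (l⁻¹ : ℂ) * ((normHermiteFun n y : ℂ) * rescaledTarget r f y))
        (l⁻¹ * x) := by
    rw [L2.inner_def]
    refine integral_congr_ae ?_
    filter_upwards [(memLp_squeezedFock r n).coeFn_toLp, hf.coeFn_toLp] with x hx hx'
    rw [squeezedFockL2, hx, hx', RCLike.inner_apply]
    simp only [squeezedFock, rescaledTarget, Complex.conj_ofReal, ← hl]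
    have e1 : l * (l⁻¹ * x) = x := by field_simp
    have e2 : l⁻¹ * x = x / l := by ring
    have e3 : 1 / √l = l⁻¹ * √l := by
      have := Real.mul_self_sqrt hl0.le
      field_simp
      linarith
    rw [e1, e2, e3]
    push_cast
    ring
  rw [h1, Measure.integral_comp_mul_left (fun y : ℝ => (l⁻¹ : ℂ) *
    ((normHermiteFun n y : ℂ) * rescaledTarget r f y)), integral_const_mul, inv_inv,
    abs_of_pos hl0, hermiteCoeff, Complex.real_smul, ← mul_assoc, mul_inv_cancel₀ (by exact_mod_cast hl0.ne'), one_mul]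

/-- The dilation sends `φ_{n,r}` to `h_n`. -/
theorem rescaledTarget_squeezedFock (r : ℝ) (n : ℕ) :
    rescaledTarget r (squeezedFock r n) = fun y => (normHermiteFun n y : ℂ) := by
  ext y
  have hl0 : 0 < √2 * Real.exp r := by positivity
  have hs : (√(√2 * Real.exp r) : ℂ) ≠ 0 := by norm_cast; positivity
  simp only [rescaledTarget, squeezedFock]
  rw [mul_div_cancel_left₀ _ hl0.ne']
  push_cast
  field_simp

theorem orthonormal_squeezedFockL2 (r : ℝ) : Orthonormal ℂ (squeezedFockL2 r) := by
  rw [orthonormal_iff_ite]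
  intro n m
  conv_lhs => rw [squeezedFockL2.eq_def r m]
  rw [inner_squeezedFockL2, rescaledTarget_squeezedFock, hermiteCoeff_normHermiteFun]

theorem MeasureTheory.MemLp.rescaledTarget (r : ℝ) {f : ℝ → ℂ} (hf : MemLp f 2 volume) :
    MemLp (rescaledTarget r f) 2 volume := by
  have hl0 : √2 * Real.exp r ≠ 0 := by positivity
  have h : MemLp (fun y : ℝ => f (√2 * Real.exp r * y)) 2 volume := by
    have hm : AEStronglyMeasurable (fun y : ℝ => f (√2 * Real.exp r * y)) volume :=
      hf.aestronglyMeasurable.comp_quasiMeasurePreserving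
        (Measure.quasiMeasurePreserving_smul (μ := (volume : Measure ℝ)) hl0)
    rw [memLp_two_iff_integrable_sq_norm hm]
    exact ((memLp_two_iff_integrable_sq_norm hf.aestronglyMeasurable).1 hf).comp_mul_left' hl0
  exact h.const_mul _

theorem span_squeezedFockL2_orthogonal (r : ℝ) :
    (Submodule.span ℂ (Set.range (squeezedFockL2 r)))ᗮ = ⊥ := by
  rw [Submodule.eq_bot_iff]
  intro x hx
  have hxm := Lp.memLp x
  have hx0 : hxm.toLp x = x := Lp.toLp_coeFn x hxm
  have hc : ∀ n, hermiteCoeff n (rescaledTarget r x) = 0 := by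
    intro n
    rw [← inner_squeezedFockL2 r n hxm, hx0]
    exact (Submodule.mem_orthogonal _ x).1 hx _ (Submodule.subset_span ⟨n, rfl⟩)
  have h := ae_eq_zero_of_hermiteCoeff_eq_zero (hxm.rescaledTarget r) hc
  have hl0 : √2 * Real.exp r ≠ 0 := by positivity
  have h2 : ∀ᵐ y : ℝ, x ((√2 * Real.exp r) * y) = 0 := by
    filter_upwards [h] with y hy
    have hs : (√(√2 * Real.exp r) : ℂ) ≠ 0 := by norm_cast; positivity
    exact (mul_eq_zero.1 hy).resolve_left hs
  have h3 := (Measure.quasiMeasurePreserving_smul (μ := (volume : Measure ℝ))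
    (inv_ne_zero hl0)).ae h2
  rw [Lp.eq_zero_iff_ae_eq_zero]
  filter_upwards [h3] with y hy
  rwa [smul_eq_mul, mul_inv_cancel_left₀ hl0] at hy

/-- The squeezed Fock functions as a Hilbert basis of `L²(ℝ)`. -/
def squeezedFockBasis (r : ℝ) : HilbertBasis ℕ ℂ (Lp ℂ 2 (volume : Measure ℝ)) :=
  HilbertBasis.mkOfOrthogonalEqBot (orthonormal_squeezedFockL2 r)
    (span_squeezedFockL2_orthogonal r)

theorem inner_squeezedFockBasis (r : ℝ) (n : ℕ) {f : ℝ → ℂ} (hf : MemLp f 2 volume) :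
    inner ℂ (squeezedFockBasis r n) (hf.toLp f) = hermiteCoeff n (rescaledTarget r f) := by
  rw [squeezedFockBasis, HilbertBasis.coe_mkOfOrthogonalEqBot, inner_squeezedFockL2]

theorem HilbertBasis.hasSum_norm_sq_inner {ι E : Type*} [NormedAddCommGroup E]
    [InnerProductSpace ℂ E] (b : HilbertBasis ι ℂ E) (x : E) :
    HasSum (fun i => ‖inner ℂ (b i) x‖ ^ 2) (‖x‖ ^ 2) := by
  have h := (b.hasSum_inner_mul_inner x x).mapL Complex.reCLM
  convert! h using 1
  · ext i
    rw [← inner_conj_symm x (b i), Complex.reCLM_apply, Complex.conj_mul', ← Complex.ofReal_pow,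
      Complex.ofReal_re]
  · simp [inner_self_eq_norm_sq_to_K, ← Complex.ofReal_pow]

/-- The squared truncation error is the tail of the squared Hermite coefficients. -/
theorem hasSum_norm_sub_squeezedFockTrunc (r : ℝ) (N : ℕ) {f : ℝ → ℂ} (hf : MemLp f 2 volume) :
    HasSum (fun n => ‖hermiteCoeff (n + N) (rescaledTarget r f)‖ ^ 2)
      (‖hf.toLp f - squeezedFockTrunc r N (hf.toLp f)‖ ^ 2) := by
  have h := (squeezedFockBasis r).hasSum_norm_sq_inner
    (hf.toLp f - squeezedFockTrunc r N (hf.toLp f))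
  have hb : ∀ n, squeezedFockBasis r n = squeezedFockL2 r n := fun n => by
    rw [squeezedFockBasis, HilbertBasis.coe_mkOfOrthogonalEqBot]
  have hlow : ∀ n < N, inner ℂ (squeezedFockBasis r n)
      (hf.toLp f - squeezedFockTrunc r N (hf.toLp f)) = 0 := by
    intro n hn
    rw [hb]
    exact (Submodule.mem_orthogonal _ _).1 (Submodule.sub_starProjection_mem_orthogonal _) _
      (Submodule.subset_span ⟨⟨n, hn⟩, rfl⟩)
  have hhigh : ∀ n, N ≤ n → inner ℂ (squeezedFockBasis r n)
      (hf.toLp f - squeezedFockTrunc r N (hf.toLp f)) = hermiteCoeff n (rescaledTarget r f) := by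
    intro n hn
    rw [inner_sub_right, inner_squeezedFockBasis, sub_eq_self]
    have hmem : squeezedFockTrunc r N (hf.toLp f) ∈ squeezedFockSpace r N :=
      Submodule.starProjection_apply_mem _ _
    refine Submodule.span_induction (p := fun x _ => inner ℂ (squeezedFockBasis r n) x = 0)
      ?_ ?_ ?_ ?_ hmem
    · rintro _ ⟨m, rfl⟩
      simp only
      rw [hb]
      exact (orthonormal_squeezedFockL2 r).2 (by have := m.2; omega)
    · simp
    · intro x y _ _ hx hy
      rw [inner_add_right, hx, hy, add_zero]
    · intro c x _ hx
      rw [inner_smul_right, hx, mul_zero]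
  rw [← hasSum_nat_add_iff' N] at h
  rw [Finset.sum_eq_zero (fun n hn => by
    rw [hlow n (Finset.mem_range.1 hn)]; simp), sub_zero] at h
  convert! h using 2 with n
  rw [hhigh _ (Nat.le_add_left _ _)]

/-! ### Algebraic decay from the annihilation operator -/

theorem exists_schwartz_eq_annihilationOp (f : SchwartzMap ℝ ℂ) :
    ∃ g : SchwartzMap ℝ ℂ, annihilationOp f = g := by
  refine ⟨((1 / √2 : ℝ) : ℂ) • (SchwartzMap.smulLeftCLM ℂ (fun y : ℝ => (y : ℂ)) f +
    SchwartzMap.derivCLM ℂ ℂ f), ?_⟩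
  ext y
  have h : (fun y : ℝ => (y : ℂ)).HasTemperateGrowth :=
    Complex.ofRealCLM.hasTemperateGrowth
  simp [annihilationOp, h, mul_add]

theorem exists_schwartz_eq_iterate_annihilationOp (f : SchwartzMap ℝ ℂ) (s : ℕ) :
    ∃ g : SchwartzMap ℝ ℂ, annihilationOp^[s] f = g := by
  induction s with
  | zero => exact ⟨f, rfl⟩
  | succ s ih =>
    obtain ⟨g, hg⟩ := ih
    obtain ⟨k, hk⟩ := exists_schwartz_eq_annihilationOp g
    exact ⟨k, by rw [Function.iterate_succ_apply', hg, hk]⟩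

/-- The iterated ladder identity `√((n+1)⋯(n+s)) ⟨h_{n+s}, f⟩ = ⟨h_n, 𝒜^s f⟩`. -/
theorem sqrt_prod_mul_hermiteCoeff_add (f : SchwartzMap ℝ ℂ) (s n : ℕ) :
    (√(∏ i ∈ Finset.range s, ((n : ℝ) + 1 + i)) : ℂ) * hermiteCoeff (n + s) f =
      hermiteCoeff n (annihilationOp^[s] f) := by
  induction s generalizing f with
  | zero => simp
  | succ s ih =>
    obtain ⟨g, hg⟩ := exists_schwartz_eq_annihilationOp f
    have hd : MemLp (deriv f) 2 volume := by
      have := (SchwartzMap.derivCLM ℂ ℂ f).memLp 2 volume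
      convert! this using 1
    have h := sqrt_mul_hermiteCoeff_succ (n + s) f.differentiable (f.memLp 2 volume) hd
    rw [Function.iterate_succ_apply, hg, ← ih g, ← hg, ← h, Finset.prod_range_succ,
      Real.sqrt_mul (Finset.prod_nonneg fun i _ => by positivity), ← add_assoc]
    push_cast
    rw [show (n : ℝ) + s + 1 = n + 1 + s by ring]
    ring

/-- Parseval's identity for the Hermite coefficients. -/
theorem hasSum_norm_hermiteCoeff_sq {w : ℝ → ℂ} (hw : MemLp w 2 volume) :
    HasSum (fun n => ‖hermiteCoeff n w‖ ^ 2) ((eLpNorm w 2 volume).toReal ^ 2) := by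
  -- The squeezing `r = -log √2` makes the dilation factor `√2 e^r` equal to `1`.
  have hl : √2 * Real.exp (-Real.log √2) = 1 := by
    rw [Real.exp_neg, Real.exp_log (by positivity)]
    exact mul_inv_cancel₀ (by positivity)
  have hr : rescaledTarget (-Real.log √2) w = w := by
    ext y
    simp [rescaledTarget, hl]
  have h := (squeezedFockBasis (-Real.log √2)).hasSum_norm_sq_inner (hw.toLp w)
  simp_rw [inner_squeezedFockBasis, hr, Lp.norm_toLp] at h
  exact h

theorem prod_range_sub_eq (M s : ℕ) : ∏ i ∈ Finset.range s, (((M + s : ℕ) : ℝ) - (i : ℝ)) =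
    ∏ i ∈ Finset.range s, ((M : ℝ) + 1 + i) := by
  rw [← Finset.prod_range_reflect]
  refine Finset.prod_congr rfl fun i hi => ?_
  have : i + 1 ≤ s := Finset.mem_range.1 hi
  rw [Nat.sub_sub, Nat.cast_sub (by omega)]
  push_cast
  ring

/-- The truncation error in terms of `𝒜^s F`: the coefficient of `F` of index `n + N` is that of
`𝒜^s F` of index `n + N - s`, divided by a square root of at least `√(N(N-1)⋯(N-s+1))`. -/
theorem norm_sub_squeezedFockTrunc_le (r : ℝ) {ψ : ℝ → ℂ} (hψ : MemLp ψ 2 volume)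
    (f : SchwartzMap ℝ ℂ) (hf : rescaledTarget r ψ = f) {s N : ℕ} (hsN : s ≤ N) :
    ‖hψ.toLp ψ - squeezedFockTrunc r N (hψ.toLp ψ)‖ ≤
      (eLpNorm (annihilationOp^[s] f) 2 volume).toReal /
        √(∏ i ∈ Finset.range s, ((N : ℝ) - (i : ℝ))) := by
  obtain ⟨M, rfl⟩ := Nat.exists_eq_add_of_le' hsN
  obtain ⟨g, hg⟩ := exists_schwartz_eq_iterate_annihilationOp f s
  have hsum := hasSum_norm_sub_squeezedFockTrunc r (M + s) hψ
  rw [hf] at hsum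
  have hb := hasSum_norm_hermiteCoeff_sq (hg ▸ g.memLp 2 volume :
    MemLp (annihilationOp^[s] f) 2 volume)
  rw [← hasSum_nat_add_iff' M] at hb
  rw [prod_range_sub_eq]
  set P := ∏ i ∈ Finset.range s, ((M : ℝ) + 1 + i) with hP
  have hP0 : 0 < P := Finset.prod_pos fun i _ => by positivity
  have hle : ∀ n, ‖hermiteCoeff (n + (M + s)) f‖ ^ 2 ≤
      P⁻¹ * ‖hermiteCoeff (n + M) (annihilationOp^[s] f)‖ ^ 2 := by
    intro n
    rw [← sqrt_prod_mul_hermiteCoeff_add f s (n + M), norm_mul, mul_pow, Complex.norm_real,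
      Real.norm_of_nonneg (Real.sqrt_nonneg _),
      Real.sq_sqrt (Finset.prod_nonneg fun i _ => by positivity), ← add_assoc, ← mul_assoc]
    refine le_mul_of_one_le_left (by positivity) ?_
    rw [← div_eq_inv_mul, one_le_div hP0]
    refine Finset.prod_le_prod (fun i _ => by positivity) fun i _ => ?_
    push_cast
    have : (0 : ℝ) ≤ n := Nat.cast_nonneg n
    linarith
  have h1 := hasSum_le hle hsum (hb.mul_left P⁻¹)
  have h2 : (0 : ℝ) ≤ ∑ i ∈ Finset.range M, ‖hermiteCoeff i (annihilationOp^[s] f)‖ ^ 2 :=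
    Finset.sum_nonneg fun i _ => by positivity
  refine abs_le_of_sq_le_sq' ?_ (by positivity) |>.2
  rw [div_pow, Real.sq_sqrt hP0.le, div_eq_inv_mul]
  refine h1.trans ?_
  gcongr
  linarith

theorem isBigO_of_le_div_sqrt_prod {e : ℕ → ℝ} (he : ∀ N, 0 ≤ e N) {W : ℝ} (hW : 0 ≤ W) (s : ℕ)
    (h : ∀ N, s ≤ N → e N ≤ W / √(∏ i ∈ Finset.range s, ((N : ℝ) - (i : ℝ)))) :
    e =O[atTop] (fun N : ℕ => (N : ℝ) ^ (-(s : ℝ) / 2)) := by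
  refine IsBigO.of_bound (W * 2 ^ ((s : ℝ) / 2)) ?_
  filter_upwards [eventually_ge_atTop (2 * s + 1)] with N hN
  have hN' : 2 * (s : ℝ) + 1 ≤ N := by exact_mod_cast hN
  have hs0 : (0 : ℝ) ≤ s := Nat.cast_nonneg s
  have hN0 : (0 : ℝ) < N := by linarith
  have hprod : ((N : ℝ) / 2) ^ s ≤ ∏ i ∈ Finset.range s, ((N : ℝ) - (i : ℝ)) := by
    calc ((N : ℝ) / 2) ^ s = ∏ _i ∈ Finset.range s, ((N : ℝ) / 2) := by simp [div_pow]
      _ ≤ _ := Finset.prod_le_prod (fun i _ => by positivity) fun i hi => by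
        have : (i : ℝ) ≤ s := by exact_mod_cast (Finset.mem_range.1 hi).le
        linarith
  rw [Real.norm_of_nonneg (he N), Real.norm_of_nonneg (by positivity)]
  calc e N ≤ W / √(∏ i ∈ Finset.range s, ((N : ℝ) - (i : ℝ))) := h N (by omega)
    _ ≤ W / √(((N : ℝ) / 2) ^ s) := by gcongr
    _ = W * 2 ^ ((s : ℝ) / 2) * (N : ℝ) ^ (-(s : ℝ) / 2) := by
      rw [Real.sqrt_eq_rpow, ← Real.rpow_natCast, ← Real.rpow_mul (by positivity),
        Real.div_rpow hN0.le (by norm_num), neg_div, Real.rpow_neg hN0.le, mul_one_div]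
      field_simp

/-! ### Shifting contours in a strip -/

/-- Cauchy's theorem for the strip `0 ≤ Im z ≤ a`: the integral over the two boundary lines agree
as soon as the function tends to `0` uniformly at the two ends of the strip. -/
theorem integral_eq_integral_add_mul_I {Φ : ℂ → ℂ} {a : ℝ} (ha : 0 < a)
    (hc : ContinuousOn Φ {z : ℂ | 0 ≤ z.im ∧ z.im ≤ a})
    (hd : DifferentiableOn ℂ Φ {z : ℂ | 0 < z.im ∧ z.im < a})
    (h0 : Integrable (fun x : ℝ => Φ x) volume)
    (h1 : Integrable (fun x : ℝ => Φ (x + a * Complex.I)) volume)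
    {b : ℝ → ℝ} (hb : Tendsto b atTop (𝓝 0))
    (hΦ : ∀ z : ℂ, 0 < z.im → z.im < a → ‖Φ z‖ ≤ b |z.re|) :
    ∫ x : ℝ, Φ x = ∫ x : ℝ, Φ (x + a * Complex.I) := by
  have hrect : ∀ T : ℝ, 0 < T →
      (∫ x : ℝ in (-T)..T, Φ x) - (∫ x : ℝ in (-T)..T, Φ (x + a * Complex.I)) +
        Complex.I • (∫ y : ℝ in (0 : ℝ)..a, Φ (T + y * Complex.I)) -
        Complex.I • (∫ y : ℝ in (0 : ℝ)..a, Φ ((-T : ℝ) + y * Complex.I)) = 0 := by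
    intro T hT
    have h := Complex.integral_boundary_rect_eq_zero_of_continuousOn_of_differentiableOn Φ
      ((-T : ℝ) : ℂ) ((T : ℂ) + a * Complex.I) (hc.mono ?_) (hd.mono ?_)
    · simpa using h
    · intro z hz
      have := hz.2
      simp only [Set.mem_preimage, Complex.ofReal_im, Complex.add_im, Complex.mul_im,
        Complex.ofReal_re, Complex.I_im, Complex.I_re, mul_one, mul_zero, add_zero, zero_add,
        Set.uIcc_of_le ha.le, Set.mem_Icc] at this
      exact this
    · intro z hz
      have := hz.2
      simp only [Set.mem_preimage, Complex.ofReal_im, Complex.add_im, Complex.mul_im,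
        Complex.ofReal_re, Complex.I_im, Complex.I_re, mul_one, mul_zero, add_zero, zero_add,
        min_eq_left ha.le, max_eq_right ha.le, Set.mem_Ioo] at this
      exact this
  have hvert : ∀ T : ℝ, ‖∫ y : ℝ in (0 : ℝ)..a, Φ (T + y * Complex.I)‖ ≤ b |T| * a := by
    intro T
    have h := intervalIntegral.norm_integral_le_of_norm_le_const_ae (a := 0) (b := a)
      (C := b |T|) (f := fun y : ℝ => Φ (T + y * Complex.I)) ?_
    · simpa [abs_of_pos ha] using h
    · have hne : ∀ᵐ y : ℝ, y ≠ a := by simp [ae_iff]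
      filter_upwards [hne] with y hya hy
      rw [Set.uIoc_of_le ha.le] at hy
      have := hΦ (T + y * Complex.I) (by simpa using hy.1)
        (by simpa using lt_of_le_of_ne hy.2 hya)
      simpa using this
  have hv1 : Tendsto (fun T : ℝ => ∫ y : ℝ in (0 : ℝ)..a, Φ (T + y * Complex.I)) atTop (𝓝 0) := by
    refine squeeze_zero_norm' (a := fun T => b T * a) ?_ (by simpa using hb.mul_const a)
    filter_upwards [eventually_gt_atTop 0] with T hT
    simpa [abs_of_pos hT] using hvert T
  have hv2 : Tendsto (fun T : ℝ => ∫ y : ℝ in (0 : ℝ)..a, Φ ((-T : ℝ) + y * Complex.I)) atTop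
      (𝓝 0) := by
    refine squeeze_zero_norm' (a := fun T => b T * a) ?_ (by simpa using hb.mul_const a)
    filter_upwards [eventually_gt_atTop 0] with T hT
    simpa [abs_of_pos hT] using hvert (-T)
  have l0 := intervalIntegral_tendsto_integral h0 tendsto_neg_atTop_atBot tendsto_id
  have l1 := intervalIntegral_tendsto_integral h1 tendsto_neg_atTop_atBot tendsto_id
  have hlim := ((l0.sub l1).add (hv1.const_smul Complex.I)).sub (hv2.const_smul Complex.I)
  have hzero := hlim.congr' (f₂ := fun _ => (0 : ℂ)) (by
    filter_upwards [eventually_gt_atTop 0] with T hT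
    exact hrect T hT)
  have := tendsto_nhds_unique hzero tendsto_const_nhds
  simpa [sub_eq_zero] using this

/-- The modulus of `e^{itz} e^{-δz²}`. -/
theorem norm_cexp_mul_cexp_neg_sq (t δ : ℝ) (z : ℂ) :
    ‖Complex.exp (t * z * Complex.I) * Complex.exp (-δ * z ^ 2)‖ =
      Real.exp (-(t * z.im)) * Real.exp (-δ * (z.re ^ 2 - z.im ^ 2)) := by
  rw [norm_mul, Complex.norm_exp, Complex.norm_exp]
  congr 2 <;> simp [pow_two]

theorem exp_abs_mul_exp_neg_sq_le {δ : ℝ} (hδ : 0 < δ) (x : ℝ) :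
    Real.exp |x| * Real.exp (-δ * x ^ 2) ≤
      Real.exp (1 / (2 * δ)) * Real.exp (-(δ / 2) * x ^ 2) := by
  rw [← Real.exp_add, ← Real.exp_add, Real.exp_le_exp]
  have h : |x| ≤ 1 / (2 * δ) + δ / 2 * x ^ 2 := by
    have h1 : 1 / (2 * δ) + δ / 2 * x ^ 2 - |x| = (δ * |x| - 1) ^ 2 / (2 * δ) := by
      rw [← sq_abs x]
      field_simp
      ring
    have : 0 ≤ (δ * |x| - 1) ^ 2 / (2 * δ) := by positivity
    linarith
  linarith

/-- Shifting the Fourier integral of `e^{-δz²} G(z)` to the line `Im z = a` gains the factor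
`e^{-ta}`. The Gaussian factor makes up for the growth of `G`. -/
theorem norm_integral_exp_mul_le {G : ℂ → ℂ} {a K : ℝ} (ha : 0 < a)
    (hd : DifferentiableOn ℂ G {z : ℂ | |z.im| < a})
    (hc : ContinuousOn G {z : ℂ | |z.im| ≤ a})
    (hG : ∀ z : ℂ, |z.im| < a → ‖G z‖ ≤ K * Real.exp |z.re|)
    (hi : Integrable (fun x : ℝ => G (x + a * Complex.I)) volume)
    {δ : ℝ} (hδ : 0 < δ) {t : ℝ} (ht : 0 ≤ t) :
    ‖∫ x : ℝ, Complex.exp (t * x * Complex.I) * (Complex.exp (-δ * x ^ 2) * G x)‖ ≤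
      Real.exp (-(a * t)) * Real.exp (δ * a ^ 2) * ∫ x : ℝ, ‖G (x + a * Complex.I)‖ := by
  set Φ : ℂ → ℂ := fun z => Complex.exp (t * z * Complex.I) * (Complex.exp (-δ * z ^ 2) * G z)
    with hΦ
  have hΦn : ∀ z, ‖Φ z‖ = Real.exp (-(t * z.im)) * Real.exp (-δ * (z.re ^ 2 - z.im ^ 2)) *
      ‖G z‖ := by
    intro z
    rw [hΦ, ← norm_cexp_mul_cexp_neg_sq, ← norm_mul, mul_assoc]
  have hK : 0 ≤ K := by
    have := (norm_nonneg _).trans (hG 0 (by simpa using ha))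
    simpa using this
  have hbound : ∀ z : ℂ, 0 ≤ z.im → z.im < a → ‖Φ z‖ ≤
      Real.exp (δ * a ^ 2) * K * Real.exp (1 / (2 * δ)) * Real.exp (-(δ / 2) * |z.re| ^ 2) := by
    intro z hz0 hza
    have e1 : Real.exp (-(t * z.im)) ≤ 1 := Real.exp_le_one_iff.2 (by nlinarith)
    have e2 : Real.exp (-δ * (z.re ^ 2 - z.im ^ 2)) ≤
        Real.exp (δ * a ^ 2) * Real.exp (-δ * z.re ^ 2) := by
      rw [← Real.exp_add, Real.exp_le_exp]
      have : z.im ^ 2 ≤ a ^ 2 := by gcongr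
      nlinarith
    have e3 := hG z (by rwa [abs_of_nonneg hz0])
    have e4 := exp_abs_mul_exp_neg_sq_le hδ z.re
    rw [hΦn, sq_abs]
    calc _ ≤ 1 * (Real.exp (δ * a ^ 2) * Real.exp (-δ * z.re ^ 2)) * (K * Real.exp |z.re|) := by
          gcongr
      _ = Real.exp (δ * a ^ 2) * K * (Real.exp |z.re| * Real.exp (-δ * z.re ^ 2)) := by ring
      _ ≤ Real.exp (δ * a ^ 2) * K * (Real.exp (1 / (2 * δ)) * Real.exp (-(δ / 2) * z.re ^ 2)) := by
          gcongr
      _ = _ := by ring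
  have hΦc : ContinuousOn Φ {z : ℂ | |z.im| ≤ a} :=
    (Continuous.continuousOn (by fun_prop)).mul
      ((Continuous.continuousOn (by fun_prop)).mul hc)
  have hΦd : DifferentiableOn ℂ Φ {z : ℂ | |z.im| < a} :=
    (Differentiable.differentiableOn (by fun_prop)).mul
      ((Differentiable.differentiableOn (by fun_prop)).mul hd)
  have hn1 : ∀ x : ℝ, ‖Φ (x + a * Complex.I)‖ ≤
      Real.exp (-(a * t)) * Real.exp (δ * a ^ 2) * ‖G (x + a * Complex.I)‖ := by
    intro x
    rw [hΦn]
    simp only [Complex.add_im, Complex.ofReal_im, Complex.mul_im, Complex.ofReal_re, Complex.I_im,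
      mul_one, Complex.I_re, mul_zero, add_zero, zero_add, Complex.add_re, Complex.mul_re, sub_zero]
    gcongr ?_ * ?_ * _
    · rw [mul_comm]
    · rw [Real.exp_le_exp]; nlinarith [sq_nonneg x]
  have hi0 : Integrable (fun x : ℝ => Φ x) volume := by
    refine ((integrable_exp_neg_mul_sq (half_pos hδ)).const_mul
      (Real.exp (δ * a ^ 2) * K * Real.exp (1 / (2 * δ)))).mono' ?_ ?_
    · refine Continuous.aestronglyMeasurable ?_
      exact hΦc.comp_continuous Complex.continuous_ofReal (fun x => by simpa using ha.le)
    · refine Eventually.of_forall fun x => ?_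
      simpa using hbound x (by simp) (by simpa using ha)
  have hi1 : Integrable (fun x : ℝ => Φ (x + a * Complex.I)) volume := by
    refine (hi.norm.const_mul (Real.exp (-(a * t)) * Real.exp (δ * a ^ 2))).mono' ?_
      (Eventually.of_forall hn1)
    refine Continuous.aestronglyMeasurable ?_
    exact hΦc.comp_continuous (by fun_prop) (fun x => by simp [abs_of_pos ha])
  have hshift := integral_eq_integral_add_mul_I ha
    (hΦc.mono fun z hz => by
      simp only [Set.mem_ofPred_eq] at hz ⊢
      rw [abs_of_nonneg hz.1]; exact hz.2)
    (hΦd.mono fun z hz => by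
      simp only [Set.mem_ofPred_eq] at hz ⊢
      rw [abs_of_pos hz.1]; exact hz.2) hi0 hi1
    (b := fun x => Real.exp (δ * a ^ 2) * K * Real.exp (1 / (2 * δ)) *
      Real.exp (-(δ / 2) * x ^ 2)) ?_ (fun z h1 h2 => hbound z h1.le h2)
  · change ‖∫ x : ℝ, Φ x‖ ≤ _
    rw [hshift, ← integral_const_mul]
    exact norm_integral_le_of_norm_le (hi.norm.const_mul _) (Eventually.of_forall hn1)
  · rw [← mul_zero (Real.exp (δ * a ^ 2) * K * Real.exp (1 / (2 * δ)))]
    refine Tendsto.const_mul _ (Real.tendsto_exp_atBot.comp ?_)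
    exact (tendsto_pow_atTop two_ne_zero).const_mul_atTop_of_neg (by linarith)

/-- Two-sided exponential decay of the Fourier integral of `e^{-δx²} G(x)`. -/
theorem norm_integral_exp_mul_le_abs {G : ℂ → ℂ} {a K : ℝ} (ha : 0 < a)
    (hd : DifferentiableOn ℂ G {z : ℂ | |z.im| < a})
    (hc : ContinuousOn G {z : ℂ | |z.im| ≤ a})
    (hG : ∀ z : ℂ, |z.im| < a → ‖G z‖ ≤ K * Real.exp |z.re|)
    (hi : Integrable (fun x : ℝ => G (x + a * Complex.I)) volume)
    (hi' : Integrable (fun x : ℝ => G (x - a * Complex.I)) volume)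
    {δ : ℝ} (hδ : 0 < δ) (t : ℝ) :
    ‖∫ x : ℝ, Complex.exp (t * x * Complex.I) * (Complex.exp (-δ * x ^ 2) * G x)‖ ≤
      Real.exp (-(a * |t|)) * Real.exp (δ * a ^ 2) *
        ((∫ x : ℝ, ‖G (x + a * Complex.I)‖) + ∫ x : ℝ, ‖G (x - a * Complex.I)‖) := by
  have p1 : 0 ≤ ∫ x : ℝ, ‖G (x + a * Complex.I)‖ := integral_nonneg fun _ => norm_nonneg _
  have p2 : 0 ≤ ∫ x : ℝ, ‖G (x - a * Complex.I)‖ := integral_nonneg fun _ => norm_nonneg _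
  rcases le_total 0 t with ht | ht
  · refine (norm_integral_exp_mul_le ha hd hc hG hi hδ ht).trans ?_
    rw [abs_of_nonneg ht]
    gcongr
    linarith
  · -- For `t ≤ 0` the reflection `z ↦ -z` exchanges the two boundary lines.
    have hneg : ∀ x : ℝ, -((x : ℂ) + a * Complex.I) = ((-x : ℝ) : ℂ) - a * Complex.I := by
      intro x; push_cast; ring
    have h := norm_integral_exp_mul_le (G := fun z => G (-z)) (t := -t) ha
      (hd.comp differentiable_neg.differentiableOn fun z hz => by simpa using hz)
      (hc.comp continuous_neg.continuousOn fun z hz => by simpa using hz)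
      (fun z hz => by simpa using hG (-z) (by simpa using hz))
      (by simp_rw [hneg]; exact hi'.comp_neg) hδ (by linarith)
    simp_rw [hneg] at h
    rw [integral_neg_eq_self (fun x : ℝ => ‖G (x - a * Complex.I)‖)] at h
    rw [← integral_neg_eq_self (fun x : ℝ =>
      Complex.exp (t * x * Complex.I) * (Complex.exp (-δ * x ^ 2) * G x))]
    have e : ∀ x : ℝ, Complex.exp (t * (-x : ℝ) * Complex.I) *
        (Complex.exp (-δ * (-x : ℝ) ^ 2) * G (-x : ℝ)) =
        Complex.exp ((-t : ℝ) * x * Complex.I) * (Complex.exp (-δ * x ^ 2) * G (-x)) := by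
      intro x
      push_cast
      simp only [neg_sq, mul_neg, neg_mul]
    simp_rw [e]
    refine h.trans ?_
    rw [abs_of_nonpos ht]
    gcongr
    linarith

/-! ### The Fourier representation of Hermite polynomials -/

theorem integrable_pow_mul_exp_neg_sq (n : ℕ) :
    Integrable (fun t : ℝ => t ^ n * Real.exp (-(1 / 4) * t ^ 2)) volume := by
  have h := integrable_rpow_mul_exp_neg_mul_sq (b := 1 / 4) (by norm_num)
    (s := (n : ℝ)) (by have := Nat.cast_nonneg (α := ℝ) n; linarith)
  simpa [Real.rpow_natCast] using h

/-- The Fourier weight `(-it)^n e^{-t²/4}`. -/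
def hermiteWeight (n : ℕ) (t : ℝ) : ℂ :=
  (-Complex.I * t) ^ n * (Real.exp (-(1 / 4) * t ^ 2) : ℝ)

theorem norm_hermiteWeight (n : ℕ) (t : ℝ) :
    ‖hermiteWeight n t‖ = |t| ^ n * Real.exp (-(1 / 4) * t ^ 2) := by
  rw [hermiteWeight, norm_mul, norm_pow, norm_mul, norm_neg, Complex.norm_I, one_mul,
    Complex.norm_real, Complex.norm_real, Real.norm_eq_abs, Real.norm_of_nonneg (by positivity)]

@[fun_prop]
theorem continuous_hermiteWeight (n : ℕ) : Continuous (hermiteWeight n) := by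
  unfold hermiteWeight
  fun_prop

theorem integrable_hermiteWeight (n : ℕ) : Integrable (hermiteWeight n) volume := by
  refine (integrable_pow_mul_exp_neg_sq n).norm.mono'
    (continuous_hermiteWeight n).aestronglyMeasurable (Eventually.of_forall fun t => ?_)
  rw [norm_hermiteWeight, norm_mul, norm_pow, Real.norm_eq_abs, Real.norm_of_nonneg (by positivity)]

theorem norm_exp_mul_mul_I (t y : ℝ) : ‖Complex.exp (t * y * Complex.I)‖ = 1 := by
  rw [← Complex.ofReal_mul, Complex.norm_exp_ofReal_mul_I]

theorem hasDerivAt_integral_hermiteWeight (n : ℕ) (y : ℝ) :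
    HasDerivAt (fun y : ℝ => ∫ t : ℝ, hermiteWeight n t * Complex.exp (t * y * Complex.I))
      (-∫ t : ℝ, hermiteWeight (n + 1) t * Complex.exp (t * y * Complex.I)) y := by
  rw [← integral_neg]
  refine (hasDerivAt_integral_of_dominated_loc_of_deriv_le (s := Set.univ)
    (F := fun (y t : ℝ) => hermiteWeight n t * Complex.exp (t * y * Complex.I))
    (F' := fun (y t : ℝ) => -(hermiteWeight (n + 1) t * Complex.exp (t * y * Complex.I)))
    (bound := fun t => ‖hermiteWeight (n + 1) t‖)
    univ_mem ?_ ?_ ?_ ?_ ?_ ?_).2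
  · exact Eventually.of_forall fun y => Continuous.aestronglyMeasurable (by fun_prop)
  · refine (integrable_hermiteWeight n).mono (Continuous.aestronglyMeasurable (by fun_prop))
      (Eventually.of_forall fun t => ?_)
    rw [norm_mul, norm_exp_mul_mul_I, mul_one]
  · exact Continuous.aestronglyMeasurable (by fun_prop)
  · refine Eventually.of_forall fun t y _ => ?_
    rw [norm_neg, norm_mul, norm_exp_mul_mul_I, mul_one]
  · exact (integrable_hermiteWeight (n + 1)).norm
  · refine Eventually.of_forall fun t y _ => ?_
    have h : HasDerivAt (fun y : ℝ => (t : ℂ) * y * Complex.I) (t * Complex.I) y := by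
      simpa using ((Complex.ofRealCLM.hasDerivAt (x := y)).const_mul (t : ℂ)).mul_const Complex.I
    convert! (h.cexp.const_mul (hermiteWeight n t)) using 1
    simp only [hermiteWeight, pow_succ]
    ring

/-- `2√π H_n(y) e^{-y²} = ∫ (-it)^n e^{-t²/4} e^{ity} dt`. -/
theorem integral_hermiteWeight (n : ℕ) (y : ℝ) :
    ∫ t : ℝ, hermiteWeight n t * Complex.exp (t * y * Complex.I) =
      ((2 * √Real.pi * ((physHermitePoly n).eval y * Real.exp (-y ^ 2)) : ℝ) : ℂ) := by
  induction n generalizing y with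
  | zero =>
    have h := fourierIntegral_gaussian (b := 1 / 4) (by norm_num) (y : ℂ)
    have e : ∀ t : ℝ, hermiteWeight 0 t * Complex.exp (t * y * Complex.I) =
        Complex.exp (Complex.I * y * t) * Complex.exp (-(1 / 4) * t ^ 2) := by
      intro t
      simp only [hermiteWeight]
      push_cast
      rw [pow_zero, one_mul, mul_comm]
      congr 2
      ring
    simp_rw [e, h]
    have h4 : (Real.pi / (1 / 4) : ℂ) ^ (1 / 2 : ℂ) = ((2 * √Real.pi : ℝ) : ℂ) := by
      have : (Real.pi / (1 / 4) : ℂ) = ((2 ^ 2 * Real.pi : ℝ) : ℂ) := by push_cast; ring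
      rw [this, show (1 / 2 : ℂ) = ((1 / 2 : ℝ) : ℂ) by push_cast; rfl,
        ← Complex.ofReal_cpow (by positivity), ← Real.sqrt_eq_rpow, Real.sqrt_mul (by positivity),
        Real.sqrt_sq (by norm_num)]
    rw [h4]
    simp only [physHermitePoly, Polynomial.eval_one, one_mul]
    push_cast
    congr 2
    ring
  | succ n ih =>
    have h1 := hasDerivAt_integral_hermiteWeight n y
    simp_rw [ih] at h1
    have h2 : HasDerivAt (fun y : ℝ => 2 * √Real.pi *
        ((physHermitePoly n).eval y * Real.exp (-y ^ 2)))
        (-(2 * √Real.pi * ((physHermitePoly (n + 1)).eval y * Real.exp (-y ^ 2)))) y := by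
      have hp := (physHermitePoly n).hasDerivAt y
      have he : HasDerivAt (fun y : ℝ => -y ^ 2) (-(2 * y)) y := by
        convert! (hasDerivAt_pow 2 y).neg using 1
        simp
      convert! (hp.mul he.exp).const_mul (2 * √Real.pi) using 1
      rw [physHermitePoly_succ_eval]
      ring
    have h3 := h1.unique h2.ofReal_comp
    rw [Complex.ofReal_neg] at h3
    exact neg_inj.1 h3

/-! ### Exponential decay of the Hermite coefficients -/

theorem integrable_abs_pow_mul_exp_neg (n : ℕ) {a : ℝ} (ha : 0 < a) :
    Integrable (fun t : ℝ => |t| ^ n * Real.exp (-(1 / 4) * t ^ 2) * Real.exp (-(a * |t|)))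
      volume := by
  refine (integrable_pow_mul_exp_neg_sq n).norm.mono'
    (Continuous.aestronglyMeasurable (by fun_prop)) (Eventually.of_forall fun t => ?_)
  rw [Real.norm_of_nonneg (by positivity), norm_mul, norm_pow, Real.norm_eq_abs,
    Real.norm_of_nonneg (by positivity)]
  refine mul_le_of_le_one_right (by positivity) (Real.exp_le_one_iff.2 ?_)
  have : 0 ≤ a * |t| := by positivity
  linarith

/-- Coefficient bound with the Gaussian regularization `e^{-δy²}` in place, obtained by inserting
the Fourier representation of `H_n(y) e^{-y²}` and exchanging the integrals. -/
theorem norm_integral_hermite_mul_regularized_le {G : ℂ → ℂ} {a K : ℝ} (ha : 0 < a)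
    (hd : DifferentiableOn ℂ G {z : ℂ | |z.im| < a})
    (hc : ContinuousOn G {z : ℂ | |z.im| ≤ a})
    (hG : ∀ z : ℂ, |z.im| < a → ‖G z‖ ≤ K * Real.exp |z.re|)
    (hi : Integrable (fun x : ℝ => G (x + a * Complex.I)) volume)
    (hi' : Integrable (fun x : ℝ => G (x - a * Complex.I)) volume)
    {δ : ℝ} (hδ : 0 < δ) (n : ℕ) :
    2 * √Real.pi * ‖∫ y : ℝ, (((physHermitePoly n).eval y * Real.exp (-y ^ 2) : ℝ) : ℂ) *
        (Complex.exp (-δ * y ^ 2) * G y)‖ ≤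
      Real.exp (δ * a ^ 2) *
        ((∫ x : ℝ, ‖G (x + a * Complex.I)‖) + ∫ x : ℝ, ‖G (x - a * Complex.I)‖) *
        ∫ t : ℝ, |t| ^ n * Real.exp (-(1 / 4) * t ^ 2) * Real.exp (-(a * |t|)) := by
  set B := (∫ x : ℝ, ‖G (x + a * Complex.I)‖) + ∫ x : ℝ, ‖G (x - a * Complex.I)‖ with hB
  set g : ℝ → ℂ := fun y => Complex.exp (-δ * y ^ 2) * G y with hg
  have hgc : Continuous g :=
    (by fun_prop : Continuous fun y : ℝ => Complex.exp (-δ * y ^ 2)).mul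
      (hc.comp_continuous Complex.continuous_ofReal (fun x => by simpa using ha.le))
  have hK : 0 ≤ K := by
    have := (norm_nonneg _).trans (hG 0 (by simpa using ha))
    simpa using this
  have hgi : Integrable g volume := by
    refine ((integrable_exp_neg_mul_sq (half_pos hδ)).const_mul
      (K * Real.exp (1 / (2 * δ)))).mono' hgc.aestronglyMeasurable (Eventually.of_forall fun y => ?_)
    have h1 := hG y (by simpa using ha)
    have h2 : ‖Complex.exp (-δ * y ^ 2)‖ = Real.exp (-δ * y ^ 2) := by
      rw [← Complex.norm_of_nonneg (Real.exp_pos _).le]; push_cast; rfl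
    have h3 := exp_abs_mul_exp_neg_sq_le hδ y
    rw [hg, norm_mul, h2]
    rw [Complex.ofReal_re] at h1
    calc _ ≤ Real.exp (-δ * y ^ 2) * (K * Real.exp |y|) := by gcongr
      _ = K * (Real.exp |y| * Real.exp (-δ * y ^ 2)) := by ring
      _ ≤ K * (Real.exp (1 / (2 * δ)) * Real.exp (-(δ / 2) * y ^ 2)) := by gcongr
      _ = _ := by ring
  have hprod : Integrable (Function.uncurry fun (y t : ℝ) =>
      hermiteWeight n t * Complex.exp (t * y * Complex.I) * g y) (volume.prod volume) := by
    refine (hgi.mul_prod (integrable_hermiteWeight n)).mono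
      (Continuous.aestronglyMeasurable (by fun_prop)) (Eventually.of_forall fun p => ?_)
    simp only [Function.uncurry]
    rw [norm_mul, norm_mul, norm_exp_mul_mul_I, mul_one, mul_comm]
    exact (norm_mul _ _).ge
  have hswap : ((2 * √Real.pi : ℝ) : ℂ) *
      ∫ y : ℝ, (((physHermitePoly n).eval y * Real.exp (-y ^ 2) : ℝ) : ℂ) * g y =
      ∫ t : ℝ, hermiteWeight n t * ∫ y : ℝ, Complex.exp (t * y * Complex.I) * g y := by
    rw [← integral_const_mul]
    calc _ = ∫ y : ℝ, ∫ t : ℝ, hermiteWeight n t * Complex.exp (t * y * Complex.I) * g y := by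
          congr 1 with y
          rw [integral_mul_const, integral_hermiteWeight]
          push_cast
          ring
      _ = ∫ t : ℝ, ∫ y : ℝ, hermiteWeight n t * Complex.exp (t * y * Complex.I) * g y :=
          integral_integral_swap hprod
      _ = _ := by
          congr 1 with t
          rw [← integral_const_mul]
          congr 1 with y
          ring
  have hnorm := congrArg norm hswap
  rw [norm_mul, Complex.norm_of_nonneg (by positivity)] at hnorm
  rw [hnorm, ← integral_const_mul]
  refine norm_integral_le_of_norm_le ((integrable_abs_pow_mul_exp_neg n ha).const_mul _)
    (Eventually.of_forall fun t => ?_)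
  have := norm_integral_exp_mul_le_abs ha hd hc hG hi hi' hδ t
  rw [norm_mul, norm_hermiteWeight]
  calc _ ≤ |t| ^ n * Real.exp (-(1 / 4) * t ^ 2) *
        (Real.exp (-(a * |t|)) * Real.exp (δ * a ^ 2) * B) := by gcongr
    _ = _ := by ring

/-- Coefficient bound by a moment of `e^{-t²/4 - a|t|}`; the regularization is removed by letting
`δ → 0`. -/
theorem norm_hermiteCoeff_le_moment {G : ℂ → ℂ} {v : ℝ → ℂ} {a K : ℝ} (ha : 0 < a)
    (hv : MemLp v 2 volume) (hGv : ∀ y : ℝ, v y = Real.exp (-y ^ 2 / 2) * G y)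
    (hd : DifferentiableOn ℂ G {z : ℂ | |z.im| < a})
    (hc : ContinuousOn G {z : ℂ | |z.im| ≤ a})
    (hG : ∀ z : ℂ, |z.im| < a → ‖G z‖ ≤ K * Real.exp |z.re|)
    (hi : Integrable (fun x : ℝ => G (x + a * Complex.I)) volume)
    (hi' : Integrable (fun x : ℝ => G (x - a * Complex.I)) volume) (n : ℕ) :
    2 * √Real.pi * ‖hermiteCoeff n v‖ ≤ hermiteNorm n *
        ((∫ x : ℝ, ‖G (x + a * Complex.I)‖) + ∫ x : ℝ, ‖G (x - a * Complex.I)‖) *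
        ∫ t : ℝ, |t| ^ n * Real.exp (-(1 / 4) * t ^ 2) * Real.exp (-(a * |t|)) := by
  set B := (∫ x : ℝ, ‖G (x + a * Complex.I)‖) + ∫ x : ℝ, ‖G (x - a * Complex.I)‖ with hB
  set M := ∫ t : ℝ, |t| ^ n * Real.exp (-(1 / 4) * t ^ 2) * Real.exp (-(a * |t|)) with hM
  have hpt : ∀ y : ℝ, (normHermiteFun n y : ℂ) * v y = hermiteNorm n *
      ((((physHermitePoly n).eval y * Real.exp (-y ^ 2) : ℝ) : ℂ) * G y) := by
    intro y
    have e : Real.exp (-y ^ 2) = Real.exp (-y ^ 2 / 2) * Real.exp (-y ^ 2 / 2) := by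
      rw [← Real.exp_add]; congr 1; ring
    rw [hGv, normHermiteFun_eq, e]
    push_cast
    ring
  have hint := integrable_normHermiteFun_mul n hv
  have hlim : Tendsto (fun δ : ℝ => ∫ y : ℝ, Complex.exp (-δ * y ^ 2) *
      ((normHermiteFun n y : ℂ) * v y)) (𝓝[>] 0) (𝓝 (hermiteCoeff n v)) := by
    refine tendsto_integral_filter_of_dominated_convergence
      (fun y => ‖(normHermiteFun n y : ℂ) * v y‖) ?_ ?_ hint.norm ?_
    · exact Eventually.of_forall fun δ =>
        (Continuous.aestronglyMeasurable (by fun_prop)).mul hint.aestronglyMeasurable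
    · filter_upwards [self_mem_nhdsWithin] with δ hδ
      refine Eventually.of_forall fun y => ?_
      have h2 : ‖Complex.exp (-δ * y ^ 2)‖ = Real.exp (-δ * y ^ 2) := by
        rw [← Complex.norm_of_nonneg (Real.exp_pos _).le]; push_cast; rfl
      rw [norm_mul, h2]
      refine mul_le_of_le_one_left (norm_nonneg _) (Real.exp_le_one_iff.2 ?_)
      have : (0 : ℝ) < δ := hδ
      nlinarith [sq_nonneg y]
    · refine Eventually.of_forall fun y => ?_
      have hcont : Continuous fun δ : ℝ => Complex.exp (-δ * y ^ 2) *
        ((normHermiteFun n y : ℂ) * v y) := by fun_prop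
      have := (hcont.tendsto 0).mono_left (nhdsWithin_le_nhds (s := Set.Ioi 0))
      simpa using this
  have hlim' : Tendsto (fun δ : ℝ => hermiteNorm n * (Real.exp (δ * a ^ 2) * B * M)) (𝓝[>] 0)
      (𝓝 (hermiteNorm n * B * M)) := by
    have hcont : Continuous fun δ : ℝ => hermiteNorm n * (Real.exp (δ * a ^ 2) * B * M) := by
      fun_prop
    have := (hcont.tendsto 0).mono_left (nhdsWithin_le_nhds (s := Set.Ioi 0))
    simpa [mul_assoc] using this
  refine le_of_tendsto_of_tendsto (hlim.norm.const_mul (2 * √Real.pi)) hlim' ?_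
  filter_upwards [self_mem_nhdsWithin] with δ hδ
  have h := norm_integral_hermite_mul_regularized_le ha hd hc hG hi hi' hδ n
  have e : ∀ y : ℝ, Complex.exp (-δ * y ^ 2) * ((normHermiteFun n y : ℂ) * v y) =
      hermiteNorm n * ((((physHermitePoly n).eval y * Real.exp (-y ^ 2) : ℝ) : ℂ) *
        (Complex.exp (-δ * y ^ 2) * G y)) := by
    intro y
    rw [hpt]
    ring
  simp_rw [e]
  rw [integral_const_mul, norm_mul, Complex.norm_of_nonneg (hermiteNorm_pos n).le]
  have := mul_le_mul_of_nonneg_left h (hermiteNorm_pos n).le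
  linarith

/-- Saddle point bound: `t^n e^{-t²/4}` has its maximum at `t₀ = √(2n)`, and its logarithm is
concave with second derivative at most `-1/2`. -/
theorem abs_pow_mul_exp_neg_le {n : ℕ} (hn : n ≠ 0) (a t : ℝ) :
    |t| ^ n * Real.exp (-(1 / 4) * t ^ 2) * Real.exp (-(a * |t|)) ≤
      √(2 * n) ^ n * Real.exp (-(n / 2)) * Real.exp (-(a * √(2 * n))) *
        Real.exp (-(1 / 4) * (|t| - √(2 * n)) ^ 2 - a * (|t| - √(2 * n))) := by
  set q := √(2 * (n : ℝ)) with hq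
  have hn0 : (0 : ℝ) < n := by positivity
  have hq0 : 0 < q := by positivity
  have hqq : q ^ 2 = 2 * n := Real.sq_sqrt (by positivity)
  have h1 : |t| / q ≤ Real.exp (|t| / q - 1) := by
    have := Real.add_one_le_exp (|t| / q - 1)
    linarith
  have h2 : |t| ^ n ≤ q ^ n * Real.exp (n * (|t| / q - 1)) := by
    rw [Real.exp_nat_mul, ← mul_pow]
    refine pow_le_pow_left₀ (abs_nonneg t) ?_ n
    rwa [div_le_iff₀' hq0] at h1
  calc |t| ^ n * Real.exp (-(1 / 4) * t ^ 2) * Real.exp (-(a * |t|))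
      ≤ (q ^ n * Real.exp (n * (|t| / q - 1))) * Real.exp (-(1 / 4) * t ^ 2) *
        Real.exp (-(a * |t|)) := by gcongr
    _ = _ := by
      simp only [mul_assoc, ← Real.exp_add]
      congr 2
      have e : (n : ℝ) * (|t| / q - 1) = q * |t| / 2 - n := by
        have : (n : ℝ) = q ^ 2 / 2 := by linarith
        rw [this]
        field_simp
      rw [e, ← sq_abs t]
      linear_combination (1 / 4) * hqq

theorem integrable_exp_neg_sq_sub (a : ℝ) :
    Integrable (fun s : ℝ => Real.exp (-(1 / 4) * s ^ 2 - a * s)) volume := by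
  have h := ((integrable_exp_neg_mul_sq (b := 1 / 4) (by norm_num)).comp_add_right
    (2 * a)).const_mul (Real.exp (a ^ 2))
  refine h.congr (Eventually.of_forall fun s => ?_)
  simp only
  rw [← Real.exp_add]
  congr 1
  ring

theorem integral_abs_pow_mul_exp_neg_le {n : ℕ} (hn : n ≠ 0) {a : ℝ} (ha : 0 < a) :
    ∫ t : ℝ, |t| ^ n * Real.exp (-(1 / 4) * t ^ 2) * Real.exp (-(a * |t|)) ≤
      √(2 * n) ^ n * Real.exp (-(n / 2)) * Real.exp (-(a * √(2 * n))) *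
        (2 * ∫ s : ℝ, Real.exp (-(1 / 4) * s ^ 2 - a * s)) := by
  set q := √(2 * (n : ℝ)) with hq
  set E : ℝ → ℝ := fun s => Real.exp (-(1 / 4) * s ^ 2 - a * s) with hE
  have hEi : Integrable E volume := integrable_exp_neg_sq_sub a
  have hE1 : Integrable (fun t => E (t - q)) volume := hEi.comp_sub_right q
  have hE2 : Integrable (fun t => E (-t - q)) volume := hE1.comp_neg
  have hint : ∫ t, (E (t - q) + E (-t - q)) = 2 * ∫ s, E s := by
    rw [integral_add hE1 hE2, integral_neg_eq_self (fun t => E (t - q)),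
      integral_sub_right_eq_self E q]
    ring
  rw [← hint, ← integral_const_mul]
  refine integral_mono (integrable_abs_pow_mul_exp_neg n ha) ((hE1.add hE2).const_mul _) fun t => ?_
  refine (abs_pow_mul_exp_neg_le hn a t).trans ?_
  rw [← hq]
  gcongr
  have p1 : 0 < E (t - q) := Real.exp_pos _
  have p2 : 0 < E (-t - q) := Real.exp_pos _
  change E (|t| - q) ≤ _
  rcases abs_choice t with h | h <;> rw [h] <;> linarith

/-- Stirling's formula gives the exact order `n^{-1/4}` of the normalized saddle point value. -/
theorem hermiteNorm_mul_saddle_sq_le {n : ℕ} (hn : n ≠ 0) :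
    (hermiteNorm n * (√(2 * n) ^ n * Real.exp (-(n / 2)))) ^ 2 ≤ (√n)⁻¹ := by
  have hn0 : (0 : ℝ) < n := by positivity
  have hfac : (0 : ℝ) < n.factorial := by positivity
  have hst := Stirling.le_factorial_stirling n
  have h1 : hermiteNorm n ^ 2 = (√Real.pi)⁻¹ * (2 ^ n * (n.factorial : ℝ))⁻¹ := by
    rw [hermiteNorm, mul_pow, ← Real.rpow_natCast, ← Real.rpow_natCast, ← Real.rpow_mul
      Real.pi_pos.le, ← Real.rpow_mul (by positivity), Real.sqrt_eq_rpow, ← Real.rpow_neg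
      Real.pi_pos.le, ← Real.rpow_neg_one (2 ^ n * (n.factorial : ℝ))]
    norm_num
  have h2 : (√(2 * (n : ℝ)) ^ n) ^ 2 = 2 ^ n * (n : ℝ) ^ n := by
    rw [← pow_mul, mul_comm n 2, pow_mul, Real.sq_sqrt (by positivity), mul_pow]
  have h3 : Real.exp (-((n : ℝ) / 2)) ^ 2 = (Real.exp 1 ^ n)⁻¹ := by
    rw [← Real.exp_nat_mul, ← Real.exp_nat_mul, ← Real.exp_neg]
    congr 1
    push_cast
    ring
  rw [mul_pow, mul_pow, h1, h2, h3]
  have hpi : 1 ≤ √Real.pi := Real.one_le_sqrt.2 (by linarith [Real.pi_gt_three])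
  have hs : √(n : ℝ) ≤ √(2 * Real.pi * n) := by
    refine Real.sqrt_le_sqrt ?_
    nlinarith [Real.pi_gt_three]
  have h4 : √(n : ℝ) * ((n : ℝ) ^ n * (Real.exp 1 ^ n)⁻¹) ≤ n.factorial := by
    refine le_trans ?_ hst
    rw [div_pow, div_eq_mul_inv]
    gcongr
  have hsn : 0 < √(n : ℝ) := by positivity
  have e : (√Real.pi)⁻¹ * (2 ^ n * (n.factorial : ℝ))⁻¹ *
      (2 ^ n * (n : ℝ) ^ n * (Real.exp 1 ^ n)⁻¹) =
      (√Real.pi)⁻¹ * (((n : ℝ) ^ n * (Real.exp 1 ^ n)⁻¹) / n.factorial) := by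
    field_simp
  rw [e]
  have h5 : ((n : ℝ) ^ n * (Real.exp 1 ^ n)⁻¹) / n.factorial ≤ (√(n : ℝ))⁻¹ := by
    rw [div_le_iff₀ hfac, inv_mul_eq_div, le_div_iff₀' hsn]
    exact h4
  calc _ ≤ 1 * (√(n : ℝ))⁻¹ := by
        gcongr
        exact inv_le_one_of_one_le₀ hpi
    _ = _ := one_mul _

/-- The coefficients are `O(n^{-1/4} e^{-a√(2n)})`. The power of `n` is needed in full: without it
the sum over the tail would cost a factor `N^{1/4}`. -/
theorem exists_norm_hermiteCoeff_sq_le {G : ℂ → ℂ} {v : ℝ → ℂ} {a K : ℝ} (ha : 0 < a)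
    (hv : MemLp v 2 volume) (hGv : ∀ y : ℝ, v y = Real.exp (-y ^ 2 / 2) * G y)
    (hd : DifferentiableOn ℂ G {z : ℂ | |z.im| < a})
    (hc : ContinuousOn G {z : ℂ | |z.im| ≤ a})
    (hG : ∀ z : ℂ, |z.im| < a → ‖G z‖ ≤ K * Real.exp |z.re|)
    (hi : Integrable (fun x : ℝ => G (x + a * Complex.I)) volume)
    (hi' : Integrable (fun x : ℝ => G (x - a * Complex.I)) volume) :
    ∃ C : ℝ, 0 ≤ C ∧ ∀ n : ℕ, n ≠ 0 →
      ‖hermiteCoeff n v‖ ^ 2 ≤ C * ((√n)⁻¹ * Real.exp (-(2 * a * √(2 * n)))) := by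
  set B := (∫ x : ℝ, ‖G (x + a * Complex.I)‖) + ∫ x : ℝ, ‖G (x - a * Complex.I)‖ with hB
  have hB0 : 0 ≤ B := add_nonneg (integral_nonneg fun _ => norm_nonneg _)
    (integral_nonneg fun _ => norm_nonneg _)
  set S := ∫ s : ℝ, Real.exp (-(1 / 4) * s ^ 2 - a * s) with hS
  have hS0 : 0 ≤ S := integral_nonneg fun _ => (Real.exp_pos _).le
  refine ⟨(B * (2 * S)) ^ 2, by positivity, fun n hn => ?_⟩
  have h1 := norm_hermiteCoeff_le_moment ha hv hGv hd hc hG hi hi' n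
  have h2 := integral_abs_pow_mul_exp_neg_le hn ha
  have h3 := hermiteNorm_mul_saddle_sq_le hn
  have hk := (hermiteNorm_pos n).le
  have hpi : 1 ≤ √Real.pi := Real.one_le_sqrt.2 (by linarith [Real.pi_gt_three])
  have h4 : ‖hermiteCoeff n v‖ ≤ hermiteNorm n * B *
      (√(2 * n) ^ n * Real.exp (-(n / 2)) * Real.exp (-(a * √(2 * n))) * (2 * S)) := by
    calc ‖hermiteCoeff n v‖ ≤ 2 * √Real.pi * ‖hermiteCoeff n v‖ :=
          le_mul_of_one_le_left (norm_nonneg _) (by linarith)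
      _ ≤ _ := h1
      _ ≤ _ := by gcongr
  have h5 : Real.exp (-(a * √(2 * n))) ^ 2 = Real.exp (-(2 * a * √(2 * n))) := by
    rw [← Real.exp_nat_mul]; congr 1; push_cast; ring
  calc ‖hermiteCoeff n v‖ ^ 2 ≤ (hermiteNorm n * B *
        (√(2 * n) ^ n * Real.exp (-(n / 2)) * Real.exp (-(a * √(2 * n))) * (2 * S))) ^ 2 := by
        gcongr
    _ = (B * (2 * S)) ^ 2 * ((hermiteNorm n * (√(2 * n) ^ n * Real.exp (-(n / 2)))) ^ 2 *
        Real.exp (-(2 * a * √(2 * n)))) := by rw [← h5]; ring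
    _ ≤ _ := by gcongr

/-! ### Exponential decay of the truncation error and the cutoff -/

/-- The weights `n^{-1/2} e^{-2a√(2n)}` are dominated by the increments of the telescoping sequence
`e^{-2a√(2n)}`, since `√(n+1) - √n ≥ 1 / (2√(n+1))`. -/
theorem inv_sqrt_mul_exp_le {a : ℝ} (ha : 0 < a) (n : ℕ) :
    (√((n + 1 : ℕ) : ℝ))⁻¹ * Real.exp (-(2 * a * √(2 * ((n + 1 : ℕ) : ℝ)))) ≤
      a⁻¹ * (Real.exp (-(2 * a * √(2 * (n : ℝ)))) -
        Real.exp (-(2 * a * √(2 * ((n + 1 : ℕ) : ℝ))))) := by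
  set p := √(n : ℝ) with hp
  set q := √((n + 1 : ℕ) : ℝ) with hq
  have hq0 : 0 < q := by positivity
  have hp0 : 0 ≤ p := Real.sqrt_nonneg _
  have hpp : p ^ 2 = n := Real.sq_sqrt (by positivity)
  have hqq : q ^ 2 = n + 1 := by rw [Real.sq_sqrt (by positivity)]; push_cast; rfl
  have hpq : p ≤ q := by
    refine Real.sqrt_le_sqrt ?_
    push_cast
    linarith
  have hdiff : q⁻¹ ≤ 2 * (q - p) := by
    rw [inv_le_iff_one_le_mul₀ hq0]
    nlinarith
  rw [Real.sqrt_mul (by norm_num) (n : ℝ), Real.sqrt_mul (by norm_num) ((n + 1 : ℕ) : ℝ)]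
  set E := Real.exp (-(2 * a * (√2 * q))) with hE
  have hE0 : 0 < E := Real.exp_pos _
  have h1 : E * (1 + 2 * a * √2 * (q - p)) ≤ Real.exp (-(2 * a * (√2 * p))) := by
    have e : Real.exp (-(2 * a * (√2 * p))) = E * Real.exp (2 * a * √2 * (q - p)) := by
      rw [hE, ← Real.exp_add]; congr 1; ring
    rw [e]
    gcongr
    linarith [Real.add_one_le_exp (2 * a * √2 * (q - p))]
  have h2 : (1 : ℝ) ≤ √2 := Real.one_le_sqrt.2 (by norm_num)
  have h3 : q⁻¹ ≤ 2 * √2 * (q - p) := by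
    have : 0 ≤ q - p := by linarith
    nlinarith
  have h4 : a * (q⁻¹ * E) ≤ Real.exp (-(2 * a * (√2 * p))) - E := by
    have : a * E * q⁻¹ ≤ a * E * (2 * √2 * (q - p)) := by gcongr
    linarith
  rwa [le_inv_mul_iff₀ ha]

/-- Summing squared coefficients of that order by telescoping. -/
theorem norm_le_of_hasSum_coeff {a C : ℝ} (ha : 0 < a) (hC : 0 ≤ C) {c : ℕ → ℂ}
    (hc : ∀ n : ℕ, n ≠ 0 → ‖c n‖ ^ 2 ≤ C * ((√n)⁻¹ * Real.exp (-(2 * a * √(2 * n)))))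
    {N : ℕ} (hN : 1 ≤ N) {e : ℝ} (he : HasSum (fun n => ‖c (n + N)‖ ^ 2) (e ^ 2)) :
    e ≤ √(C * a⁻¹) * Real.exp (-a * √(2 * ((N : ℝ) - 1))) := by
  obtain ⟨M, rfl⟩ := Nat.exists_eq_add_of_le' hN
  set E : ℕ → ℝ := fun n => Real.exp (-(2 * a * √(2 * ((n + M : ℕ) : ℝ)))) with hE
  have hterm : ∀ n, ‖c (n + (M + 1))‖ ^ 2 ≤ C * a⁻¹ * (E n - E (n + 1)) := by
    intro n
    have h1 := hc (n + M + 1) (by omega)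
    have h2 := inv_sqrt_mul_exp_le ha (n + M)
    have h3 : n + 1 + M = n + M + 1 := by omega
    simp only [hE, h3]
    rw [← add_assoc]
    refine h1.trans ?_
    rw [mul_assoc C]
    exact mul_le_mul_of_nonneg_left h2 hC
  have hsum : e ^ 2 ≤ C * a⁻¹ * E 0 := by
    refine le_of_tendsto' he.tendsto_sum_nat fun m => ?_
    calc ∑ i ∈ Finset.range m, ‖c (i + (M + 1))‖ ^ 2
        ≤ ∑ i ∈ Finset.range m, C * a⁻¹ * (E i - E (i + 1)) :=
          Finset.sum_le_sum fun i _ => hterm i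
      _ = C * a⁻¹ * (E 0 - E m) := by rw [← Finset.mul_sum, Finset.sum_range_sub']
      _ ≤ _ := by
        have : 0 < E m := Real.exp_pos _
        gcongr
        linarith
  refine abs_le_of_sq_le_sq' ?_ (by positivity) |>.2
  rw [mul_pow, Real.sq_sqrt (by positivity), ← Real.exp_nat_mul]
  refine hsum.trans (le_of_eq ?_)
  have hM : ((M + 1 : ℕ) : ℝ) - 1 = M := by push_cast; ring
  simp only [hE, zero_add, hM]
  congr 2
  push_cast
  ring

/-- The growth bound at infinity, with continuity on the remaining compact part, gives a bound by
`e^{|Re z|}` on the whole open strip. -/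
theorem exists_norm_le_exp_abs_re {G : ℂ → ℂ} {a K σ₀ R : ℝ}
    (hc : ContinuousOn G {z : ℂ | |z.im| ≤ a}) (hK : 0 < K)
    (hG : ∀ z : ℂ, |z.im| < a → R ≤ ‖z‖ → ‖G z‖ ≤ K * ‖z‖ ^ σ₀) :
    ∃ K' : ℝ, ∀ z : ℂ, |z.im| < a → ‖G z‖ ≤ K' * Real.exp |z.re| := by
  obtain ⟨m, hm⟩ := exists_nat_ge σ₀
  have hcomp : IsCompact ({z : ℂ | |z.im| ≤ a} ∩ Metric.closedBall 0 (max R 1)) :=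
    (isCompact_closedBall _ _).inter_left
      (isClosed_le (by fun_prop) continuous_const)
  obtain ⟨L, hL⟩ := hcomp.exists_bound_of_continuousOn (hc.mono Set.inter_subset_left)
  refine ⟨max L (K * (m.factorial * Real.exp a)), fun z hz => ?_⟩
  rcases le_total ‖z‖ (max R 1) with h | h
  · have h1 := hL z ⟨hz.le, by simpa using h⟩
    calc ‖G z‖ ≤ L := h1
      _ ≤ max L (K * (m.factorial * Real.exp a)) * 1 := by rw [mul_one]; exact le_max_left _ _
      _ ≤ _ := by
        exact mul_le_mul_of_nonneg_left (Real.one_le_exp (abs_nonneg _))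
          (le_max_of_le_right (by positivity))
  · have h1 : 1 ≤ ‖z‖ := (le_max_right _ _).trans h
    have h2 : ‖z‖ ^ σ₀ ≤ ‖z‖ ^ m := by
      rw [← Real.rpow_natCast]
      exact Real.rpow_le_rpow_of_exponent_le h1 hm
    have h3 : ‖z‖ ^ m ≤ m.factorial * Real.exp ‖z‖ := by
      have := Real.pow_div_factorial_le_exp ‖z‖ (norm_nonneg z) m
      rwa [div_le_iff₀' (by positivity)] at this
    have h4 : Real.exp ‖z‖ ≤ Real.exp a * Real.exp |z.re| := by
      rw [← Real.exp_add, Real.exp_le_exp]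
      linarith [Complex.norm_le_abs_re_add_abs_im z]
    calc ‖G z‖ ≤ K * ‖z‖ ^ σ₀ := hG z hz ((le_max_left _ _).trans h)
      _ ≤ K * (m.factorial * (Real.exp a * Real.exp |z.re|)) := by
        gcongr
        exact h2.trans (h3.trans (by gcongr))
      _ = K * (m.factorial * Real.exp a) * Real.exp |z.re| := by ring
      _ ≤ _ := by gcongr; exact le_max_right _ _

theorem exists_norm_sub_squeezedFockTrunc_le_exp (r : ℝ) {ψ : ℝ → ℂ} (hψ : MemLp ψ 2 volume)
    {a : ℝ} (ha : 0 < a) (h : StripAnalyticWeighted a (rescaledTarget r ψ)) :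
    ∃ C : ℝ, ∀ N : ℕ, 1 ≤ N → ‖hψ.toLp ψ - squeezedFockTrunc r N (hψ.toLp ψ)‖ ≤
      C * Real.exp (-a * √(2 * ((N : ℝ) - 1))) := by
  obtain ⟨Fc, hF, hd, hc, ⟨K, hK, σ₀, R, hG⟩, hi, hi'⟩ := h
  set G : ℂ → ℂ := fun z => Complex.exp (z ^ 2 / 2) * Fc z with hGdef
  have hGd : DifferentiableOn ℂ G {z : ℂ | |z.im| < a} :=
    (Differentiable.differentiableOn (by fun_prop)).mul hd
  have hGc : ContinuousOn G {z : ℂ | |z.im| ≤ a} :=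
    (Continuous.continuousOn (by fun_prop)).mul hc
  obtain ⟨K', hK'⟩ := exists_norm_le_exp_abs_re hGc hK hG
  have hGv : ∀ y : ℝ, rescaledTarget r ψ y = Real.exp (-y ^ 2 / 2) * G y := by
    intro y
    have e : (Real.exp (-y ^ 2 / 2) : ℂ) * Complex.exp ((y : ℂ) ^ 2 / 2) = 1 := by
      push_cast
      rw [← Complex.exp_add, ← Complex.exp_zero]
      congr 1
      ring
    rw [hGdef, ← hF, ← mul_assoc, e, one_mul]
  obtain ⟨C, hC, hcoef⟩ := exists_norm_hermiteCoeff_sq_le ha (hψ.rescaledTarget r) hGv hGd hGc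
    hK' hi hi'
  exact ⟨√(C * a⁻¹), fun N hN => norm_le_of_hasSum_coeff ha hC hcoef hN
    (hasSum_norm_sub_squeezedFockTrunc r N hψ)⟩

/-- An error bound `C e^{-a√(2(N-1))}` yields accuracy `ε` as soon as `N ≥ k log²(1/ε)` with
`k > 1 / (2a²)`, for all small `ε`. -/
theorem eventually_le_of_le_exp_sqrt {e : ℕ → ℝ} {a C k : ℝ} (ha : 0 < a)
    (he : ∀ N : ℕ, 1 ≤ N → e N ≤ C * Real.exp (-a * √(2 * ((N : ℝ) - 1))))
    (hk : 1 / (2 * a ^ 2) < k) :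
    ∀ᶠ ε : ℝ in 𝓝[>] 0, ∀ N : ℕ, k * Real.log (1 / ε) ^ 2 ≤ (N : ℝ) → e N ≤ ε := by
  have hk0 : 0 < k := lt_trans (by positivity) hk
  -- The slack in the constant: `a √(2k) = 1 + η` with `η > 0`.
  have hη : 1 < a * √(2 * k) := by
    have h1 : 1 < a ^ 2 * (2 * k) := by
      rw [div_lt_iff₀ (by positivity)] at hk
      linarith
    have h2 : (a * √(2 * k)) ^ 2 = a ^ 2 * (2 * k) := by
      rw [mul_pow, Real.sq_sqrt (by positivity)]
    by_contra! hcon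
    nlinarith [show 0 ≤ a * √(2 * k) by positivity]
  set D := max C 1 with hD
  have hD0 : 0 < D := lt_max_of_lt_right one_pos
  have hlog : Tendsto (fun ε : ℝ => Real.log (1 / ε)) (𝓝[>] 0) atTop := by
    simp_rw [one_div]
    exact Real.tendsto_log_atTop.comp tendsto_inv_nhdsGT_zero
  filter_upwards [self_mem_nhdsWithin, hlog.eventually_gt_atTop 0, hlog.eventually_ge_atTop
    ((Real.log D + a * √2) / (a * √(2 * k) - 1))] with ε hε hL0 hL N hN
  have hε0 : (0 : ℝ) < ε := hε
  set L := Real.log (1 / ε) with hLdef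
  rw [div_le_iff₀ (by linarith)] at hL
  have hN1 : 1 ≤ N := by
    have : (0 : ℝ) < N := lt_of_lt_of_le (by positivity) hN
    exact_mod_cast this
  have hN1' : (1 : ℝ) ≤ N := by exact_mod_cast hN1
  have hsq : √(2 * k) * L - √2 ≤ √(2 * ((N : ℝ) - 1)) := by
    have h1 : √(2 * k) * L ≤ √(2 * (N : ℝ)) := by
      refine Real.le_sqrt_of_sq_le ?_
      rw [mul_pow, Real.sq_sqrt (by positivity)]
      linarith
    have h2 : √(2 * (N : ℝ)) ≤ √(2 * ((N : ℝ) - 1)) + √2 := by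
      rw [Real.sqrt_le_left (by positivity), add_sq, Real.sq_sqrt (by linarith),
        Real.sq_sqrt (by norm_num)]
      have : 0 ≤ √(2 * ((N : ℝ) - 1)) * √2 := by positivity
      linarith
    linarith
  have hε' : ε = Real.exp (-L) := by
    rw [hLdef, one_div, Real.log_inv, neg_neg, Real.exp_log hε0]
  calc e N ≤ C * Real.exp (-a * √(2 * ((N : ℝ) - 1))) := he N hN1
    _ ≤ D * Real.exp (-a * √(2 * ((N : ℝ) - 1))) := by gcongr; exact le_max_left _ _
    _ = Real.exp (Real.log D - a * √(2 * ((N : ℝ) - 1))) := by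
      rw [Real.exp_sub, Real.exp_log hD0, neg_mul, Real.exp_neg, div_eq_mul_inv]
    _ ≤ Real.exp (-L) := by
      rw [Real.exp_le_exp]
      have := mul_le_mul_of_nonneg_left hsq ha.le
      linarith
    _ = ε := hε'.symm

theorem theorem2 (r' : ℝ) (g : ℝ → ℂ) (𝒩 : ℂ)
    (hψ : MemLp (idealKernelState 𝒩 g) 2 (volume : Measure ℝ))
    (hnorm : ‖hψ.toLp (idealKernelState 𝒩 g)‖ = 1)
    (hF : ∃ f : SchwartzMap ℝ ℂ, ∀ y : ℝ, f y = rescaledTarget r' (idealKernelState 𝒩 g) y) :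
    -- part (i)
    (∀ s : ℕ, 1 ≤ s →
      MemLp (annihilationOp^[s] (rescaledTarget r' (idealKernelState 𝒩 g))) 2
          (volume : Measure ℝ) ∧
      (∀ N : ℕ, s ≤ N →
        ‖hψ.toLp (idealKernelState 𝒩 g) -
            squeezedFockTrunc r' N (hψ.toLp (idealKernelState 𝒩 g))‖ ≤
          (eLpNorm (annihilationOp^[s] (rescaledTarget r' (idealKernelState 𝒩 g))) 2
              (volume : Measure ℝ)).toReal /
            √(∏ i ∈ Finset.range s, ((N : ℝ) - (i : ℝ)))) ∧
      (fun N : ℕ => ‖hψ.toLp (idealKernelState 𝒩 g) -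
            squeezedFockTrunc r' N (hψ.toLp (idealKernelState 𝒩 g))‖) =O[atTop]
          (fun N : ℕ => (N : ℝ) ^ (-(s : ℝ) / 2))) ∧
    -- part (ii)
    (∀ ρ : ℝ, 0 < ρ →
      StripAnalyticWeighted (ρ / Real.exp r') (rescaledTarget r' (idealKernelState 𝒩 g)) →
      (∃ C : ℝ, ∀ N : ℕ, 1 ≤ N →
        ‖hψ.toLp (idealKernelState 𝒩 g) -
            squeezedFockTrunc r' N (hψ.toLp (idealKernelState 𝒩 g))‖ ≤
          C * Real.exp (-(ρ / Real.exp r') * √(2 * ((N : ℝ) - 1)))) ∧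
      (∀ κ : ℝ, 1 / (2 * ρ ^ 2) < κ →
        ∀ᶠ ε : ℝ in 𝓝[>] 0, ∀ N : ℕ,
          κ * Real.exp (2 * r') * Real.log (1 / ε) ^ 2 ≤ (N : ℝ) →
          ‖hψ.toLp (idealKernelState 𝒩 g) -
            squeezedFockTrunc r' N (hψ.toLp (idealKernelState 𝒩 g))‖ ≤ ε)) := by
  set ψ := idealKernelState 𝒩 g
  obtain ⟨f, hf⟩ := hF
  have hfF : rescaledTarget r' ψ = f := funext fun y => (hf y).symm
  refine ⟨fun s _ => ⟨?_, fun N hN => ?_, ?_⟩, fun ρ hρ hstrip => ?_⟩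
  · rw [hfF]
    obtain ⟨k, hk⟩ := exists_schwartz_eq_iterate_annihilationOp f s
    rw [hk]
    exact k.memLp 2 volume
  · rw [hfF]
    exact norm_sub_squeezedFockTrunc_le r' hψ f hfF hN
  · exact isBigO_of_le_div_sqrt_prod (fun N => norm_nonneg _) ENNReal.toReal_nonneg s
      fun N hN => norm_sub_squeezedFockTrunc_le r' hψ f hfF hN
  · have ha : 0 < ρ / Real.exp r' := by positivity
    obtain ⟨C, hC⟩ := exists_norm_sub_squeezedFockTrunc_le_exp r' hψ ha hstrip
    refine ⟨⟨C, hC⟩, fun κ hκ => ?_⟩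
    refine eventually_le_of_le_exp_sqrt ha hC ?_
    have e : 1 / (2 * (ρ / Real.exp r') ^ 2) = 1 / (2 * ρ ^ 2) * Real.exp (2 * r') := by
      rw [two_mul r', Real.exp_add]
      field_simp
    rw [e]
    gcongr

end
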